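/- A bipartite multigraph with sides $L,R$ in which every left vertex has degree $d$ is a $(k,\varepsilon)$-extractor if for all $S\subseteq L$ with $|S|\ge k$ and all $T\subseteq R$, $$\left|\frac{|E(S,T)|}{d\,|S|}-\frac{|T|}{|R|}\right|<\varepsilon ,$$ where $|E(S,T)|$ counts edges between $S$ and $T$ with multiplicity. The bipartite double cover of an undirected multigraph on $V$ with symmetric adjacency matrix $A\in\mathbb N^{V\times V}$ (loops allowed, each counted once) is the bipartite multigraph with sides two copies of $V$ and $A_{uv}$ edges from the left copy of $u$ to the right copy of $v$. A $d$-regular multigraph with adjacency matrix $A$ has spectral expansion at most $\lambda$ if $\|\tfrac1d Ax\|_2\le\lambda\|x\|_2$ for every $x\in\mathbb R^V$ with $\sum_v x_v=0$. **Theorem.** There are a function $D:(0,\infty)\times(0,1)\to\mathbb N_{>0}$ and a real polynomial $P$ in two variables with $D(\varepsilon,\alpha)\le P(1/\varepsilon,1/\alpha)$ for all $\varepsilon>0$, $\alpha\in(0,1)$, and there is a deterministic algorithm (Turing machine) that on input $n,d\in\mathbb N$ outputs, in time polynomial in $n$ and $d$, the bipartite double cover of an undirected multigraph $H_{n,d}$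 on $n$ vertices, such that the following holds. For all $\varepsilon>0$ and $\alpha\in(0,1)$, with $D=D(\varepsilon,\alpha)$, and for every $n\in\mathbb N$ and every $k\ge\max(\lfloor\alpha n\rfloor,1)$, the bipartite double cover of $H_{n,D}$, which has both sides of size $n$, is a $(k,\varepsilon)$-extractor and is biregular of degree $D$ (every left vertex and every right vertex has degree $D$); moreover $H_{n,D}$ is $D$-regular and has spectral expansion at most $\varepsilon\sqrt{\alpha/2}$. -/

import Mathlib

/-- A bipartite multigraph with left side `L` and right side `R`:
`mult u v` is the number of parallel edges joining `u` to `v`. -/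
structure BipartiteMultigraph (L R : Type) where
  mult : L → R → ℕ

namespace BipartiteMultigraph

/-- The number `|E(S, T)|` of edges (with multiplicity) between `S ⊆ L` and `T ⊆ R`. -/
def edgesBetween {L R : Type} (G : BipartiteMultigraph L R) (S : Finset L) (T : Finset R) : ℕ :=
  ∑ u ∈ S, ∑ v ∈ T, G.mult u v

/-- Every left vertex has degree `d`. -/
def IsLeftRegular {L R : Type} [Fintype R] (G : BipartiteMultigraph L R) (d : ℕ) : Prop :=
  ∀ u, ∑ v, G.mult u v = d

/-- Every right vertex has degree `d`. -/
def IsRightRegular {L R : Type} [Fintype L] (G : BipartiteMultigraph L R) (d : ℕ) : Prop :=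
  ∀ v, ∑ u, G.mult u v = d

/-- Every vertex, on either side, has degree `d`. -/
def IsBiregular {L R : Type} [Fintype L] [Fintype R] (G : BipartiteMultigraph L R)
    (d : ℕ) : Prop :=
  G.IsLeftRegular d ∧ G.IsRightRegular d

/-- `G` is a `(k, ε)`-extractor of left degree `d`: for every set `S` of at least `k` left
vertices and every set `T` of right vertices, the probability that a random edge leaving `S`
enters `T` differs by less than `ε` from the density of `T`. -/
def IsExtractor {L R : Type} [Fintype L] [Fintype R] (G : BipartiteMultigraph L R)
    (d k : ℕ) (ε : ℝ) : Prop :=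
  G.IsLeftRegular d ∧
    ∀ (S : Finset L) (T : Finset R), k ≤ S.card →
      |(G.edgesBetween S T : ℝ) / ((d : ℝ) * (S.card : ℝ))
        - (T.card : ℝ) / (Fintype.card R : ℝ)| < ε

end BipartiteMultigraph

/-- An undirected multigraph (parallel edges and loops allowed) on the vertex set `V`, given by
its adjacency matrix: `mult u v` is the number of edges joining `u` and `v`.  A loop is counted
once in the adjacency matrix and in the degree, as is usual for spectral expanders. -/
structure UndirectedMultigraph (V : Type) where
  mult : V → V → ℕ
  symm : ∀ u v, mult u v = mult v u

namespace UndirectedMultigraph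

/-- Every vertex has degree `d`. -/
def IsRegular {V : Type} [Fintype V] (G : UndirectedMultigraph V) (d : ℕ) : Prop :=
  ∀ u, ∑ v, G.mult u v = d

/-- The transition matrix of the random walk on a `d`-regular multigraph. -/
noncomputable def walkMatrix {V : Type} (G : UndirectedMultigraph V) (d : ℕ) : Matrix V V ℝ :=
  Matrix.of fun u v => (G.mult u v : ℝ) / (d : ℝ)

/-- The `d`-regular multigraph `G` is a spectral expander with parameter `lam`: the random walk
matrix contracts the Euclidean norm of every vector orthogonal to the constants by a factor at
most `lam`.  (That is, its second largest eigenvalue in absolute value is at most `lam`.) -/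
def IsSpectralExpander {V : Type} [Fintype V] (G : UndirectedMultigraph V)
    (d : ℕ) (lam : ℝ) : Prop :=
  G.IsRegular d ∧
    ∀ x : V → ℝ, ∑ v, x v = 0 →
      ‖WithLp.toLp 2 ((G.walkMatrix d).mulVec x)‖ ≤ lam * ‖WithLp.toLp 2 x‖

/-- The bipartite double cover: two copies of `V`, and for every edge `uv` of `G` an edge from
the left copy of `u` to the right copy of `v` and one from the left copy of `v` to the right
copy of `u` (a single edge if `uv` is a loop). -/
def doubleCover {V : Type} (G : UndirectedMultigraph V) : BipartiteMultigraph V V where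
  mult := G.mult

end UndirectedMultigraph

/-- The pair `(n, d)` with both numbers in unary, as the word `1ⁿ 0 1ᵈ`. -/
def encodeSizeDegree (p : ℕ × ℕ) : List Bool :=
  List.replicate p.1 true ++ false :: List.replicate p.2 true

/-- A bipartite multigraph with sides of size `n`, written as its `n × n` table of edge
multiplicities, row by row, with each entry `a` written in unary as `1ᵃ 0`. -/
def encodeBipartite (G : Σ n : ℕ, BipartiteMultigraph (Fin n) (Fin n)) : List Bool :=
  (List.finRange G.1).flatMap fun u =>
    (List.finRange G.1).flatMap fun v =>
      List.replicate (G.2.mult u v) true ++ [false]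

/-- The family `G n d` of bipartite multigraphs (with sides of size `n` and intended degree `d`)
is explicit: one deterministic Turing machine writes down `G n d` on input `(n, d)` within a
number of steps polynomial in `n` and `d`, that is, polynomial in the size of the graph. -/
def IsExplicitFamily (G : ∀ n _d : ℕ, BipartiteMultigraph (Fin n) (Fin n)) : Prop :=
  Nonempty (Turing.TM2ComputableInPolyTime encodeSizeDegree encodeBipartite
    (fun p : ℕ × ℕ => (⟨p.1, G p.1 p.2⟩ : Σ n : ℕ, BipartiteMultigraph (Fin n) (Fin n))))

/-! Two things are needed: expanders of constant degree on every number n of vertices, with a gap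
independent of n, and a Turing machine that writes down their powers.

The graph. Let m be least with n ≤ m², so that m² ≤ 2n. The torus (ℤ/m)² with a shear, a shift and
the swap of coordinates has a spectral gap independent of m (`sum_sq_le_energy`). On the Fourier
side a function with small energy is almost invariant under a shear and a swap of frequencies, and
carries little mass where the shift turns by at least a quarter. On a quadrant of the remaining
frequencies, the shear and its conjugate by the swap map the box injectively to two disjoint sets,
both inside the box of twice the size. The box would thus have to carry nearly twice its own mass,
up to far frequencies, so its mass is small. Merging the points with indices i and i + n gives n
vertices, and filling up with loops gives degree exactly 16; the gap survives
(`sum_sq_le_sum_vertexStep`). Six loops at each vertex keep the spectrum away from -1, so the walk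
contracts by a factor `gapConstant` < 1 (`Matrix.sum_sq_mulVec_le_of_poincare`). Walks of length k
form a graph of degree 16^k and expansion `gapConstant ^ k`. With k a constant times log(1 / (ε α)),
the expansion is small enough and the degree is polynomial in 1/ε and 1/α. A form of the expander
mixing lemma turns expansion into extraction (`IsSpectralExpander.isExtractor_doubleCover`).

The machine. Programs act on unary registers, and all their loops have the same length W, linear in
n + d, so running time is polynomial by construction (`compile_reachesWithin`). It remains to bound
the registers and to identify the output (`nonempty_tm2ComputableInPolyTime`). Multiplicities are
found by brute force: every w < d is tried as the code of a walk, its base 16 digits being the edge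
labels (`run_tableCmd`). -/

/-! ### Bounded-loop programs and their compilation to a stack machine -/

/-- Programs over unary registers `R`, writing a word of bits from right to left.  The command
`loop c` runs `c` a fixed number of times, which depends on the length of the input only. -/
inductive Cmd (R : Type) : Type
  | skip : Cmd R
  | inc (r : R) : Cmd R
  | dec (r : R) : Cmd R
  | emit (b : Bool) : Cmd R
  | seq (c₁ c₂ : Cmd R) : Cmd R
  | ifz (r : R) (c₁ c₂ : Cmd R) : Cmd R
  | loop (c : Cmd R) : Cmd R

/-- The memory of a program: the contents of the registers, and the word written so far. -/
@[ext]
structure Memory (R : Type) where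
  reg : R → ℕ
  out : List Bool

namespace Memory

variable {R : Type} [DecidableEq R]

/-- Assign the value `x` to the register `r`. -/
def set (s : Memory R) (r : R) (x : ℕ) : Memory R :=
  ⟨Function.update s.reg r x, s.out⟩

/-- Write the bit `b`. -/
def write (s : Memory R) (b : Bool) : Memory R :=
  ⟨s.reg, b :: s.out⟩

end Memory

namespace Cmd

variable {R : Type}

/-- The effect of a program on the memory, if loops are run `W` times. -/
def run [DecidableEq R] (W : ℕ) : Cmd R → Memory R → Memory R
  | skip, s => s
  | inc r, s => s.set r (s.reg r + 1)
  | dec r, s => s.set r (s.reg r - 1)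
  | emit b, s => s.write b
  | seq c₁ c₂, s => c₂.run W (c₁.run W s)
  | ifz r c₁ c₂, s => if s.reg r = 0 then c₁.run W s else c₂.run W s
  | loop c, s => (c.run W)^[W] s

/-- The maximal depth of nested loops. -/
def height : Cmd R → ℕ
  | seq c₁ c₂ => max c₁.height c₂.height
  | ifz _ c₁ c₂ => max c₁.height c₂.height
  | loop c => c.height + 1
  | _ => 0

/-- A bound for the number of steps as a polynomial in the length of a loop. -/
noncomputable def cost : Cmd R → Polynomial ℕ
  | seq c₁ c₂ => c₁.cost + c₂.cost
  | ifz _ c₁ c₂ => 1 + c₁.cost + c₂.cost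
  | loop c => Polynomial.X * (c.cost + 2) + 2
  | _ => 1

/-- The labels of the stack machine executing a program. -/
inductive Label : Cmd R → Type
  | skip : Label .skip
  | inc (r : R) : Label (.inc r)
  | dec (r : R) : Label (.dec r)
  | emit (b : Bool) : Label (.emit b)
  | fst {c₁ c₂ : Cmd R} (l : Label c₁) : Label (.seq c₁ c₂)
  | snd {c₁ c₂ : Cmd R} (l : Label c₂) : Label (.seq c₁ c₂)
  | test {r : R} {c₁ c₂ : Cmd R} : Label (.ifz r c₁ c₂)
  | pos {r : R} {c₁ c₂ : Cmd R} (l : Label c₁) : Label (.ifz r c₁ c₂)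
  | neg {r : R} {c₁ c₂ : Cmd R} (l : Label c₂) : Label (.ifz r c₁ c₂)
  | head {c : Cmd R} : Label (.loop c)
  | restore {c : Cmd R} : Label (.loop c)
  | body {c : Cmd R} (l : Label c) : Label (.loop c)

theorem finite_label (c : Cmd R) : Finite c.Label := by
  induction c with
  | skip => exact Finite.of_surjective (fun _ : Unit => .skip) fun l => ⟨(), by cases l; rfl⟩
  | inc r => exact Finite.of_surjective (fun _ : Unit => .inc r) fun l => ⟨(), by cases l; rfl⟩
  | dec r => exact Finite.of_surjective (fun _ : Unit => .dec r) fun l => ⟨(), by cases l; rfl⟩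
  | emit b => exact Finite.of_surjective (fun _ : Unit => .emit b) fun l => ⟨(), by cases l; rfl⟩
  | seq c₁ c₂ ih₁ ih₂ =>
    refine Finite.of_surjective (Sum.elim (.fst (c₂ := c₂)) (.snd (c₁ := c₁))) fun l => ?_
    cases l with
    | fst l => exact ⟨.inl l, rfl⟩
    | snd l => exact ⟨.inr l, rfl⟩
  | ifz r c₁ c₂ ih₁ ih₂ =>
    refine Finite.of_surjective (Sum.elim (fun _ : Unit => .test)
      (Sum.elim (.pos (r := r) (c₂ := c₂)) (.neg (c₁ := c₁)))) fun l => ?_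
    cases l with
    | test => exact ⟨.inl (), rfl⟩
    | pos l => exact ⟨.inr (.inl l), rfl⟩
    | neg l => exact ⟨.inr (.inr l), rfl⟩
  | loop c ih =>
    refine Finite.of_surjective (Sum.elim (fun b : Bool => if b then .head else .restore)
      .body) fun l => ?_
    cases l with
    | head => exact ⟨.inl true, rfl⟩
    | restore => exact ⟨.inl false, rfl⟩
    | body l => exact ⟨.inr l, rfl⟩

/-- The label at which the execution of a program starts. -/
def entry : (c : Cmd R) → c.Label
  | skip => .skip
  | inc r => .inc r
  | dec r => .dec r
  | emit b => .emit b
  | seq c₁ _ => .fst c₁.entry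
  | ifz _ _ _ => .test
  | loop _ => .head

end Cmd

/-- The stacks of the machine executing a program: input, output, registers, and for every nesting
depth of loops a counter and a backup of the part of the counter that was used up. -/
inductive Stack (R : Type) (J : ℕ) : Type
  | inp : Stack R J
  | out : Stack R J
  | reg (r : R) : Stack R J
  | counter (j : Fin J) : Stack R J
  | backup (j : Fin J) : Stack R J
  deriving DecidableEq, Fintype

namespace Stack

variable {R : Type} {J : ℕ}

/-- The contents of the stacks that represent the given data. -/
def content (I : List Bool) (s : Memory R) (C B : Fin J → ℕ) : Stack R J → List Bool
  | inp => I
  | out => s.out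
  | reg r => List.replicate (s.reg r) true
  | counter j => List.replicate (C j) true
  | backup j => List.replicate (B j) true

variable [DecidableEq R]

/-- A machine step rewrites single stacks. These lemmas bring the result back to the form `content`,
so that runs can be described by registers and counters alone. -/
theorem update_out (I : List Bool) (s : Memory R) (C B : Fin J → ℕ) (b : Bool) :
    Function.update (content I s C B) out (b :: s.out) = content I (s.write b) C B := by
  funext k; cases k <;> simp [content, Memory.write]

theorem update_inp (I I' : List Bool) (s : Memory R) (C B : Fin J → ℕ) :
    Function.update (content I s C B) inp I' = content I' s C B := by
  funext k; cases k <;> simp [content]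

theorem update_reg (I : List Bool) (s : Memory R) (C B : Fin J → ℕ) (r : R) (x : ℕ) :
    Function.update (content I s C B) (reg r) (List.replicate x true)
      = content I (s.set r x) C B := by
  funext k; cases k <;> simp [content, Function.update_apply, Memory.set]
  split_ifs <;> rfl

theorem update_counter (I : List Bool) (s : Memory R) (C B : Fin J → ℕ) (j : Fin J) (x : ℕ) :
    Function.update (content I s C B) (counter j) (List.replicate x true)
      = content I s (Function.update C j x) B := by
  funext k; cases k <;> simp [content, Function.update_apply]
  split_ifs <;> rfl

theorem update_backup (I : List Bool) (s : Memory R) (C B : Fin J → ℕ) (j : Fin J) (x : ℕ) :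
    Function.update (content I s C B) (backup j) (List.replicate x true)
      = content I s C (Function.update B j x) := by
  funext k; cases k <;> simp [content, Function.update_apply]
  split_ifs <;> rfl

end Stack

/-- Statements of the stack machine with labels in `Λ`; its internal state is the symbol that was
read last. -/
abbrev StackStmt (R : Type) (J : ℕ) (Λ : Type) : Type :=
  Turing.TM2.Stmt (fun _ : Stack R J => Bool) Λ (Option Bool)

/-- Configurations of the stack machine with labels in `Λ`. -/
abbrev StackCfg (R : Type) (J : ℕ) (Λ : Type) : Type :=
  Turing.TM2.Cfg (fun _ : Stack R J => Bool) Λ (Option Bool)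

section Reaches

variable {R : Type} [DecidableEq R] {J : ℕ} {Λ : Type}

/-- The machine `M` gets from `a` to `b` in at most `t` steps. -/
def ReachesWithin (M : Λ → StackStmt R J Λ) (t : ℕ) (a b : StackCfg R J Λ) : Prop :=
  ∃ k ≤ t, (flip bind (Turing.TM2.step M))^[k] (some a) = some b

theorem ReachesWithin.trans {M : Λ → StackStmt R J Λ} {t₁ t₂ : ℕ} {a b c : StackCfg R J Λ}
    (h₁ : ReachesWithin M t₁ a b) (h₂ : ReachesWithin M t₂ b c) :
    ReachesWithin M (t₁ + t₂) a c := by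
  obtain ⟨k₁, hk₁, e₁⟩ := h₁
  obtain ⟨k₂, hk₂, e₂⟩ := h₂
  exact ⟨k₂ + k₁, by omega, by rw [Function.iterate_add_apply, e₁, e₂]⟩

theorem ReachesWithin.mono {M : Λ → StackStmt R J Λ} {t t' : ℕ} {a b : StackCfg R J Λ}
    (h : ReachesWithin M t a b) (ht : t ≤ t') : ReachesWithin M t' a b := by
  obtain ⟨k, hk, e⟩ := h
  exact ⟨k, hk.trans ht, e⟩

theorem ReachesWithin.step (M : Λ → StackStmt R J Λ) {l : Λ} {v : Option Bool}
    {S : Stack R J → List Bool} {q : StackStmt R J Λ} {b : StackCfg R J Λ}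
    (hq : M l = q) (hb : Turing.TM2.stepAux q v S = b) :
    ReachesWithin M 1 ⟨some l, v, S⟩ b :=
  ⟨1, le_rfl, by subst hq hb; rfl⟩

end Reaches

namespace Cmd

variable {R : Type}

/-- The number of the counter used by a loop with the given body. -/
def loopIndex (J : ℕ) [NeZero J] (c : Cmd R) : Fin J := Fin.ofNat J c.height

open Turing.TM2.Stmt in
/-- The statements of the machine executing the program `c`, whose labels are embedded into `Λ` by
`f` and which jumps to `next` at the end. -/
def compile {J : ℕ} [NeZero J] {Λ : Type} : (c : Cmd R) → (c.Label → Λ) → Λ → c.Label →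
    StackStmt R J Λ
  | skip, _, next, _ => goto fun _ => next
  | inc r, _, next, _ => push (.reg r) (fun _ => true) (goto fun _ => next)
  | dec r, _, next, _ => pop (.reg r) (fun v _ => v) (goto fun _ => next)
  | emit b, _, next, _ => push .out (fun _ => b) (goto fun _ => next)
  | seq c₁ c₂, f, _, .fst l => c₁.compile (fun l => f (.fst l)) (f (.snd c₂.entry)) l
  | seq _ c₂, f, next, .snd l => c₂.compile (fun l => f (.snd l)) next l
  | ifz r c₁ c₂, f, _, .test =>
      peek (.reg r) (fun _ x => x) (branch Option.isSome
        (goto fun _ => f (.neg c₂.entry)) (goto fun _ => f (.pos c₁.entry)))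
  | ifz _ c₁ _, f, next, .pos l => c₁.compile (fun l => f (.pos l)) next l
  | ifz _ _ c₂, f, next, .neg l => c₂.compile (fun l => f (.neg l)) next l
  | loop c, f, _, .head =>
      pop (.counter (c.loopIndex J)) (fun _ x => x) (branch Option.isSome
        (push (.backup (c.loopIndex J)) (fun _ => true) (goto fun _ => f (.body c.entry)))
        (goto fun _ => f .restore))
  | loop c, f, next, .restore =>
      pop (.backup (c.loopIndex J)) (fun _ x => x) (branch Option.isSome
        (push (.counter (c.loopIndex J)) (fun _ => true) (goto fun _ => f .restore))
        (goto fun _ => next))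
  | loop c, f, _, .body l => c.compile (fun l => f (.body l)) (f .head) l

end Cmd

namespace Cmd

open Stack

variable {R : Type} [DecidableEq R]

/-- Refilling the counter is what lets a later loop of the same height, or the next pass of an
enclosing loop, find it full again. -/
theorem reachesWithin_restore {J : ℕ} [NeZero J] {Λ : Type} (W : ℕ) (c : Cmd R)
    (M : Λ → StackStmt R J Λ) (f : (loop c).Label → Λ) (next : Λ)
    (hM : ∀ l, M (f l) = (loop c).compile f next l)
    (I : List Bool) (s : Memory R) (C B : Fin J → ℕ)
    (hC : C (c.loopIndex J) = W) (hB : B (c.loopIndex J) = 0) (v : Option Bool)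
    (k i : ℕ) (hik : i + k = W) :
    ∃ v', ReachesWithin M (k + 1)
      ⟨some (f .restore), v, content I s (Function.update C (c.loopIndex J) i)
        (Function.update B (c.loopIndex J) k)⟩
      ⟨some next, v', content I s C B⟩ := by
  induction k generalizing i v with
  | zero =>
    refine ⟨none, ReachesWithin.step M (hM _) ?_⟩
    rw [add_zero] at hik
    have h1 : Function.update C (c.loopIndex J) i = C := by
      rw [hik, ← hC, Function.update_eq_self]
    have h2 : Function.update B (c.loopIndex J) 0 = B := by
      rw [← hB, Function.update_eq_self]
    have h3 : content I s C B (backup (c.loopIndex J)) = List.replicate 0 true := by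
      simp [content, hB]
    rw [h1, h2]
    simp only [compile, Turing.TM2.stepAux]
    rw [h3, List.replicate_zero, List.tail_nil, ← List.replicate_zero (a := true),
      update_backup, h2]
    rfl
  | succ k ih =>
    obtain ⟨v', hv'⟩ := ih (some true) (i + 1) (by omega)
    refine ⟨v', (ReachesWithin.trans (ReachesWithin.step M (hM _) ?_) hv').mono (by omega)⟩
    simp only [compile, Turing.TM2.stepAux]
    have h1 : content I s (Function.update C (c.loopIndex J) i)
        (Function.update B (c.loopIndex J) (k + 1)) (backup (c.loopIndex J))
        = List.replicate (k + 1) true := by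
      simp [content]
    rw [h1, List.replicate_succ, List.tail_cons, update_backup, Function.update_idem]
    have h2 : content I s (Function.update C (c.loopIndex J) i)
        (Function.update B (c.loopIndex J) k) (counter (c.loopIndex J))
        = List.replicate i true := by
      simp [content]
    rw [h2, ← List.replicate_succ (n := i), update_counter, Function.update_idem]
    rfl

/-- The machine compiled from a program has the effect of this program on the stacks. -/
theorem compile_reachesWithin (W : ℕ) (c : Cmd R) {J : ℕ} [NeZero J] {Λ : Type}
    (M : Λ → StackStmt R J Λ) (f : c.Label → Λ) (next : Λ)
    (hM : ∀ l, M (f l) = c.compile f next l) (hJ : c.height ≤ J)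
    (I : List Bool) (s : Memory R) (C B : Fin J → ℕ)
    (hCB : ∀ j : Fin J, j.val < c.height → C j = W ∧ B j = 0) (v : Option Bool) :
    ∃ v', ReachesWithin M (c.cost.eval W) ⟨some (f c.entry), v, content I s C B⟩
      ⟨some next, v', content I (c.run W s) C B⟩ := by
  induction c generalizing Λ next s v C B with
  | skip => exact ⟨v, (ReachesWithin.step M (hM _) rfl).mono (by simp [cost])⟩
  | inc r =>
    refine ⟨v, (ReachesWithin.step M (hM _) ?_).mono (by simp [cost])⟩
    simp only [entry, compile, Turing.TM2.stepAux, run]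
    rw [← update_reg]
    rfl
  | dec r =>
    refine ⟨v, (ReachesWithin.step M (hM _) ?_).mono (by simp [cost])⟩
    simp only [entry, compile, Turing.TM2.stepAux, run]
    rw [← update_reg]
    simp [content]
  | emit b =>
    refine ⟨v, (ReachesWithin.step M (hM _) ?_).mono (by simp [cost])⟩
    simp only [entry, compile, Turing.TM2.stepAux, run]
    rw [← update_out]
    rfl
  | seq c₁ c₂ ih₁ ih₂ =>
    simp only [height, max_le_iff, lt_max_iff] at hJ hCB
    obtain ⟨v₁, h₁⟩ := ih₁ M (fun l => f (.fst l)) (f (.snd c₂.entry)) (fun l => hM (.fst l))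
      hJ.1 s C B (fun j hj => hCB j (.inl hj)) v
    obtain ⟨v₂, h₂⟩ := ih₂ M (fun l => f (.snd l)) next (fun l => hM (.snd l))
      hJ.2 (c₁.run W s) C B (fun j hj => hCB j (.inr hj)) v₁
    refine ⟨v₂, ?_⟩
    exact (h₁.trans h₂).mono (by simp [cost])
  | ifz r c₁ c₂ ih₁ ih₂ =>
    simp only [height, max_le_iff, lt_max_iff] at hJ hCB
    rcases Nat.eq_zero_or_pos (s.reg r) with hr | hr
    · obtain ⟨v₁, h₁⟩ := ih₁ M (fun l => f (.pos l)) next (fun l => hM (.pos l))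
        hJ.1 s C B (fun j hj => hCB j (.inl hj)) none
      refine ⟨v₁, ?_⟩
      rw [run, if_pos hr]
      refine (ReachesWithin.trans (ReachesWithin.step M (hM _) ?_) h₁).mono ?_
      · have h1 : content I s C B (reg r) = [] := by simp [content, hr]
        simp only [entry, compile, Turing.TM2.stepAux]
        rw [h1]
        rfl
      · simp [cost]
    · obtain ⟨v₁, h₁⟩ := ih₂ M (fun l => f (.neg l)) next (fun l => hM (.neg l))
        hJ.2 s C B (fun j hj => hCB j (.inr hj)) (some true)
      refine ⟨v₁, ?_⟩
      rw [run, if_neg hr.ne']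
      refine (ReachesWithin.trans (ReachesWithin.step M (hM _) ?_) h₁).mono ?_
      · have h1 : (content I s C B (reg r)).head? = some true := by
          simp [content, List.head?_replicate, hr.ne']
        simp only [entry, compile, Turing.TM2.stepAux]
        rw [h1]
        rfl
      · simp only [cost, Polynomial.eval_add, Polynomial.eval_one]; omega
  | loop c ih =>
    simp only [height] at hJ hCB
    -- The loop owns the counter numbered by the height of its body. Loops inside the body have
    -- smaller height, so they use other counters.
    set j₀ : Fin J := c.loopIndex J with hj₀
    have hval : j₀.val = c.height := Nat.mod_eq_of_lt (by omega)
    obtain ⟨hC, hB⟩ := hCB j₀ (by omega)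
    -- Here i passes are left and k are done. Each pass costs the body and one step at the head; the
    -- rest is one step to leave the loop and W + 1 to restore the counter.
    have key : ∀ (i k : ℕ) (s : Memory R) (v : Option Bool), i + k = W →
        ∃ v', ReachesWithin M (i * (c.cost.eval W + 1) + 1 + (W + 1))
          ⟨some (f .head), v, content I s (Function.update C j₀ i)
            (Function.update B j₀ k)⟩
          ⟨some next, v', content I ((c.run W)^[i] s) C B⟩ := by
      intro i
      induction i with
      | zero =>
        intro k s v hik
        rw [zero_add] at hik
        obtain ⟨v', hv'⟩ := reachesWithin_restore W c M f next hM I s C B hC hB none k 0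
          (by omega)
        refine ⟨v', (ReachesWithin.trans (ReachesWithin.step M (hM _) ?_) hv').mono
          (by omega)⟩
        simp only [compile, Turing.TM2.stepAux]
        have h1 : content I s (Function.update C j₀ 0) (Function.update B j₀ k) (counter j₀)
            = List.replicate 0 true := by simp [content]
        rw [h1, List.replicate_zero, List.tail_nil, ← List.replicate_zero (a := true),
          update_counter, Function.update_idem]
        rfl
      | succ i ihi =>
        intro k s v hik
        obtain ⟨v₁, h₁⟩ := ih M (fun l => f (.body l)) (f .head) (fun l => hM (.body l))
          (by omega) s (Function.update C j₀ i) (Function.update B j₀ (k + 1))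
          (fun j hj => by
            have hne : j ≠ j₀ := fun h => by rw [h, hval] at hj; omega
            rw [Function.update_of_ne hne, Function.update_of_ne hne]
            exact hCB j (by omega)) (some true)
        obtain ⟨v₂, h₂⟩ := ihi (k + 1) (c.run W s) v₁ (by omega)
        refine ⟨v₂, (ReachesWithin.trans (ReachesWithin.step M (hM _) ?_)
          (h₁.trans h₂)).mono ?_⟩
        · simp only [compile, Turing.TM2.stepAux]
          have h1 : content I s (Function.update C j₀ (i + 1)) (Function.update B j₀ k)
              (counter j₀) = List.replicate (i + 1) true := by simp [content]
          rw [h1, List.replicate_succ, List.tail_cons, update_counter, Function.update_idem]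
          have h2 : content I s (Function.update C j₀ i) (Function.update B j₀ k)
              (backup j₀) = List.replicate k true := by simp [content]
          rw [h2, ← List.replicate_succ (n := k), update_backup, Function.update_idem]
          rfl
        · ring_nf; omega
    obtain ⟨v', hv'⟩ := key W 0 s v (by omega)
    refine ⟨v', ?_⟩
    rw [← hC, Function.update_eq_self, hC, ← hB, Function.update_eq_self] at hv'
    refine hv'.mono ?_
    simp only [cost, Polynomial.eval_add, Polynomial.eval_mul, Polynomial.eval_X,
      Polynomial.eval_ofNat]
    ring_nf; omega

end Cmd

/-! ### The complete machine: reading the input, execution, emptying the stacks -/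

/-- The labels of the machine that reads a pair of numbers, executes a program, and empties all
stacks except the output. -/
inductive MachineLabel {R : Type} (c : Cmd R) : Type
  | readSize : MachineLabel c
  | readDegree : MachineLabel c
  | exec (l : c.Label) : MachineLabel c
  | drain : MachineLabel c

namespace Cmd

open Stack Turing

variable {R : Type}

theorem finite_machineLabel (c : Cmd R) : Finite (MachineLabel c) := by
  have := c.finite_label
  refine Finite.of_surjective (Sum.elim (fun i : Fin 3 =>
    if i = 0 then MachineLabel.readSize else if i = 1 then .readDegree else .drain) .exec)
    fun l => ?_
  cases l with
  | readSize => exact ⟨.inl 0, rfl⟩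
  | readDegree => exact ⟨.inl 1, rfl⟩
  | drain => exact ⟨.inl 2, rfl⟩
  | exec l => exact ⟨.inr l, rfl⟩

section

variable {J : ℕ} {Λ : Type}

/-- Increase each of the listed counters. -/
def pushCounters (l : List (Fin J)) (q : StackStmt R J Λ) : StackStmt R J Λ :=
  l.foldr (fun j q => .push (.counter j) (fun _ => true) q) q

/-- Decrease each of the listed counters. -/
def popCounters (l : List (Fin J)) (q : StackStmt R J Λ) : StackStmt R J Λ :=
  l.foldr (fun j q => .pop (.counter j) (fun v _ => v) q) q

/-- Decrease each of the listed registers. -/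
def popRegisters (l : List R) (q : StackStmt R J Λ) : StackStmt R J Λ :=
  l.foldr (fun r q => .pop (.reg r) (fun v _ => v) q) q

/-- Increase every counter by `C`. -/
def fillCounters (C : ℕ) (q : StackStmt R J Λ) : StackStmt R J Λ :=
  (pushCounters (List.finRange J))^[C] q

variable [DecidableEq R] (v : Option Bool) (I : List Bool) (s : Memory R)
  (X B : Fin J → ℕ)

theorem stepAux_pushCounters (l : List (Fin J)) (q : StackStmt R J Λ) :
    TM2.stepAux (pushCounters l q) v (content I s X B)
      = TM2.stepAux q v (content I s (fun j => X j + l.count j) B) := by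
  induction l generalizing X with
  | nil => rfl
  | cons j l ih =>
    simp only [pushCounters, List.foldr_cons, TM2.stepAux] at ih ⊢
    have h : true :: content I s X B (counter j) = List.replicate (X j + 1) true := rfl
    rw [h, update_counter, ih]
    congr 2
    funext i
    rcases eq_or_ne i j with rfl | hij
    · simp; omega
    · simp [hij, hij.symm]

theorem stepAux_popCounters (l : List (Fin J)) (q : StackStmt R J Λ) :
    TM2.stepAux (popCounters l q) v (content I s X B)
      = TM2.stepAux q v (content I s (fun j => X j - l.count j) B) := by
  induction l generalizing X with
  | nil => rfl
  | cons j l ih =>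
    simp only [popCounters, List.foldr_cons, TM2.stepAux] at ih ⊢
    have h : (content I s X B (counter j)).tail = List.replicate (X j - 1) true := by
      simp [content]
    rw [h, update_counter, ih]
    congr 2
    funext i
    rcases eq_or_ne i j with rfl | hij
    · simp; omega
    · simp [hij, hij.symm]

theorem stepAux_popRegisters (l : List R) (q : StackStmt R J Λ) :
    TM2.stepAux (popRegisters l q) v (content I s X B)
      = TM2.stepAux q v (content I ⟨fun r => s.reg r - l.count r, s.out⟩ X B) := by
  induction l generalizing s with
  | nil => rfl
  | cons r l ih =>
    simp only [popRegisters, List.foldr_cons, TM2.stepAux] at ih ⊢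
    have h : (content I s X B (reg r)).tail = List.replicate (s.reg r - 1) true := by
      simp [content]
    rw [h, update_reg, ih]
    congr 3
    funext i
    rcases eq_or_ne i r with rfl | hij
    · simp [Memory.set]; omega
    · simp [Memory.set, hij, hij.symm]

theorem stepAux_fillCounters (C : ℕ) (q : StackStmt R J Λ) :
    TM2.stepAux (fillCounters C q) v (content I s X B)
      = TM2.stepAux q v (content I s (fun j => X j + C) B) := by
  induction C generalizing X with
  | zero => rfl
  | succ C ih =>
    rw [fillCounters, Function.iterate_succ_apply', stepAux_pushCounters]
    have h : (fun j => X j + (List.finRange J).count j) = fun j => X j + 1 := by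
      funext j
      rw [List.count_eq_one_of_mem (List.nodup_finRange J) (List.mem_finRange j)]
    rw [h]
    refine (ih _).trans ?_
    congr 2
    funext j
    omega

end

section

variable [DecidableEq R] [Fintype R]

/-- The statements of the machine that reads a pair of numbers into the registers `rn` and `rd`,
executes the program `c`, and empties all stacks except the output. -/
noncomputable def machineStmt (c : Cmd R) (rn rd : R) (C : ℕ) :
    MachineLabel c → StackStmt R (c.height + 1) (MachineLabel c)
  | .readSize => .pop .inp (fun _ x => x) (.branch (fun x => x == some true)
      (fillCounters C (.push (.reg rn) (fun _ => true) (.goto fun _ => .readSize)))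
      (fillCounters C (.goto fun _ => .readDegree)))
  | .readDegree => .pop .inp (fun _ x => x) (.branch Option.isSome
      (fillCounters C (.push (.reg rd) (fun _ => true) (.goto fun _ => .readDegree)))
      (.goto fun _ => .exec c.entry))
  | .exec l => c.compile .exec .drain l
  | .drain => .peek (.counter 0) (fun _ x => x) (.branch Option.isSome
      (popCounters (List.finRange _) (popRegisters Finset.univ.toList (.goto fun _ => .drain)))
      .halt)

variable (c : Cmd R) (rn rd : R) (C : ℕ)

/-- The separator also fills the counters, hence the factor n + 1. With the d symbols read
afterwards, every counter ends at C (n + d + 1), the common length of all loops. -/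
theorem reachesWithin_readSize (n m : ℕ) (I : List Bool) (s : Memory R) (v : Option Bool) :
    ReachesWithin (c.machineStmt rn rd C) (n + 1)
      ⟨some .readSize, v, content (List.replicate n true ++ false :: I) s (fun _ => m)
        (fun _ => 0)⟩
      ⟨some .readDegree, some false, content I (s.set rn (s.reg rn + n))
        (fun _ => m + (n + 1) * C) (fun _ => 0)⟩ := by
  induction n generalizing m s v with
  | zero =>
    refine (ReachesWithin.step _ rfl ?_)
    simp only [machineStmt, TM2.stepAux, update_inp]
    have h : content (List.replicate 0 true ++ false :: I) s (fun _ : Fin (c.height + 1) => m)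
        (fun _ => 0) inp = false :: I := rfl
    have h' : s.set rn (s.reg rn + 0) = s := by
      simp [Memory.set]
    rw [h, h']
    simp only [List.head?_cons, List.tail_cons, stepAux_fillCounters, TM2.stepAux]
    simp
  | succ n ih =>
    have e₁ : (s.set rn (s.reg rn + 1)).set rn ((s.set rn (s.reg rn + 1)).reg rn + n)
        = s.set rn (s.reg rn + (n + 1)) := by
      simp [Memory.set, Nat.add_assoc, Nat.add_comm 1]
    have e₂ : m + C + (n + 1) * C = m + (n + 1 + 1) * C := by ring
    have h₂ := ih (m + C) (s.set rn (s.reg rn + 1)) (some true)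
    rw [e₁, e₂] at h₂
    refine (ReachesWithin.trans (ReachesWithin.step _ rfl ?_) h₂).mono (by omega)
    · simp only [machineStmt, TM2.stepAux, update_inp]
      have h : content (List.replicate (n + 1) true ++ false :: I) s
          (fun _ : Fin (c.height + 1) => m) (fun _ => 0) inp
          = true :: (List.replicate n true ++ false :: I) := rfl
      rw [h]
      simp only [List.head?_cons, List.tail_cons, stepAux_fillCounters, TM2.stepAux,
        BEq.rfl, cond_true]
      rw [← update_reg]
      rfl

theorem reachesWithin_readDegree (d m : ℕ) (s : Memory R) (v : Option Bool) :
    ReachesWithin (c.machineStmt rn rd C) (d + 1)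
      ⟨some .readDegree, v, content (List.replicate d true) s (fun _ => m) (fun _ => 0)⟩
      ⟨some (.exec c.entry), none, content [] (s.set rd (s.reg rd + d))
        (fun _ => m + d * C) (fun _ => 0)⟩ := by
  induction d generalizing m s v with
  | zero =>
    refine (ReachesWithin.step _ rfl ?_)
    simp only [machineStmt, TM2.stepAux, update_inp]
    have h : content (List.replicate 0 true) s (fun _ : Fin (c.height + 1) => m)
        (fun _ => 0) inp = [] := rfl
    have h' : s.set rd (s.reg rd + 0) = s := by
      simp [Memory.set]
    rw [h, h']
    simp
  | succ d ih =>
    have e₁ : (s.set rd (s.reg rd + 1)).set rd ((s.set rd (s.reg rd + 1)).reg rd + d)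
        = s.set rd (s.reg rd + (d + 1)) := by
      simp [Memory.set, Nat.add_assoc, Nat.add_comm 1]
    have e₂ : m + C + d * C = m + (d + 1) * C := by ring
    have h₂ := ih (m + C) (s.set rd (s.reg rd + 1)) (some true)
    rw [e₁, e₂] at h₂
    refine (ReachesWithin.trans (ReachesWithin.step _ rfl ?_) h₂).mono (by omega)
    · simp only [machineStmt, TM2.stepAux, update_inp]
      have h : content (List.replicate (d + 1) true) s
          (fun _ : Fin (c.height + 1) => m) (fun _ => 0) inp
          = true :: List.replicate d true := rfl
      rw [h]
      simp only [List.head?_cons, List.tail_cons, stepAux_fillCounters, TM2.stepAux,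
        Option.isSome_some, cond_true]
      rw [← update_reg]
      rfl

/-- A halting configuration must have all stacks except the output empty. Counter 0 serves as the
clock: its value m bounds every register, and popping an empty stack is harmless. -/
theorem reachesWithin_drain (m : ℕ) (s : Memory R) (hs : ∀ r, s.reg r ≤ m) (v : Option Bool) :
    ReachesWithin (c.machineStmt rn rd C) (m + 1)
      ⟨some .drain, v, content [] s (fun _ => m) (fun _ => 0)⟩
      ⟨none, none, content [] ⟨fun _ => 0, s.out⟩ (fun _ => 0) (fun _ => 0)⟩ := by
  induction m generalizing s v with
  | zero =>
    refine (ReachesWithin.step _ rfl ?_)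
    have h' : s = ⟨fun _ => 0, s.out⟩ := by
      ext1
      · funext r; exact Nat.le_zero.1 (hs r)
      · rfl
    rw [← h']
    rfl
  | succ m ih =>
    refine (ReachesWithin.trans (ReachesWithin.step _ rfl ?_)
      (ih ⟨fun r => s.reg r - 1, s.out⟩ (fun r => ?_) (some true))).mono (by omega)
    · simp only [machineStmt, TM2.stepAux]
      have h : content [] s (fun _ : Fin (c.height + 1) => m + 1) (fun _ => 0) (counter 0)
          = true :: List.replicate m true := rfl
      rw [h]
      simp only [List.head?_cons, Option.isSome_some, cond_true, stepAux_popCounters,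
        stepAux_popRegisters, TM2.stepAux]
      congr 3
      · funext r
        rw [List.count_eq_one_of_mem (Finset.nodup_toList _) (by simp)]
      · funext j
        rw [List.count_eq_one_of_mem (List.nodup_finRange _) (by simp)]
        rfl
    · have := hs r
      show s.reg r - 1 ≤ m
      omega

/-- The stack machine executing the program `c`. -/
noncomputable def machine : FinTM2 where
  K := Stack R (c.height + 1)
  k₀ := .inp
  k₁ := .out
  Γ := fun _ => Bool
  Λ := MachineLabel c
  main := .readSize
  ΛFin := @Fintype.ofFinite _ c.finite_machineLabel
  σ := Option Bool
  initialState := none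
  Γk₀Fin := inferInstanceAs (Fintype Bool)
  m := c.machineStmt rn rd C

/-- A function on pairs of numbers is computable in polynomial time if there is a program that
computes it and whose registers stay small. -/
theorem nonempty_tm2ComputableInPolyTime (hne : rn ≠ rd) {β : Type} (enc : β → List Bool)
    (f : ℕ × ℕ → β)
    (hout : ∀ n d, (c.run (C * (n + d + 1))
      (((⟨fun _ => 0, []⟩ : Memory R).set rn n).set rd d)).out = enc (f (n, d)))
    (hreg : ∀ n d r, (c.run (C * (n + d + 1))
      (((⟨fun _ => 0, []⟩ : Memory R).set rn n).set rd d)).reg r ≤ C * (n + d + 1)) :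
    Nonempty (TM2ComputableInPolyTime encodeSizeDegree enc f) := by
  have key : ∀ n d, ReachesWithin (c.machineStmt rn rd C)
      ((Polynomial.X + 1 + c.cost.comp (Polynomial.C C * Polynomial.X)
        + (Polynomial.C C * Polynomial.X + 1)).eval (n + d + 1))
      ⟨some .readSize, none, content (encodeSizeDegree (n, d)) ⟨fun _ => 0, []⟩ (fun _ => 0)
        (fun _ => 0)⟩
      ⟨none, none, content [] ⟨fun _ => 0, enc (f (n, d))⟩ (fun _ => 0) (fun _ => 0)⟩ := by
    intro n d
    have h1 := c.reachesWithin_readSize rn rd C n 0 (List.replicate d true)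
      ⟨fun _ => 0, []⟩ none
    have h2 := c.reachesWithin_readDegree rn rd C d (0 + (n + 1) * C)
      ((⟨fun _ => 0, []⟩ : Memory R).set rn (0 + n)) (some false)
    have hW : 0 + (n + 1) * C + d * C = C * (n + d + 1) := by ring
    have h0 : ((⟨fun _ => 0, []⟩ : Memory R).set rn (0 + n)).reg rd + d = d := by
      simp [Memory.set, hne.symm]
    rw [h0, hW, Nat.zero_add n] at h2
    rw [Nat.zero_add n] at h1
    obtain ⟨v, h3⟩ := c.compile_reachesWithin (C * (n + d + 1)) (c.machineStmt rn rd C) .exec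
      .drain (fun l => rfl) (Nat.le_succ _) []
      (((⟨fun _ => 0, []⟩ : Memory R).set rn n).set rd d) (fun _ => C * (n + d + 1))
      (fun _ => 0) (fun _ _ => ⟨rfl, rfl⟩) none
    have h4 := c.reachesWithin_drain rn rd C (C * (n + d + 1)) _ (hreg n d) v
    rw [hout] at h4
    refine (((h1.trans h2).trans h3).trans h4).mono ?_
    simp only [Polynomial.eval_add, Polynomial.eval_comp, Polynomial.eval_mul,
      Polynomial.eval_C, Polynomial.eval_X, Polynomial.eval_one]
    omega
  refine ⟨{
    tm := c.machine rn rd C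
    inputAlphabet := Equiv.refl Bool
    outputAlphabet := Equiv.refl Bool
    time := Polynomial.X + 1 + c.cost.comp (Polynomial.C C * Polynomial.X)
        + (Polynomial.C C * Polynomial.X + 1)
    outputsFun := fun p => Classical.choice ?_ }⟩
  obtain ⟨k, hk, e⟩ := key p.1 p.2
  have hlen : (encodeSizeDegree p).length = p.1 + p.2 + 1 := by
    simp [encodeSizeDegree]; omega
  rw [hlen]
  refine ⟨⟨⟨k, ?_⟩, hk⟩⟩
  have hi : ∀ I : List Bool, initList (c.machine rn rd C) I
      = (⟨some .readSize, none, content I ⟨fun _ => 0, []⟩ (fun _ => 0) (fun _ => 0)⟩ :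
        StackCfg R (c.height + 1) (MachineLabel c)) := by
    intro I
    show Turing.TM2.Cfg.mk _ _ _ = _
    congr 1
    funext j
    cases j <;> rfl
  have hf : ∀ O : List Bool, haltList (c.machine rn rd C) O
      = (⟨none, none, content [] ⟨fun _ => 0, O⟩ (fun _ => 0) (fun _ => 0)⟩ :
        StackCfg R (c.height + 1) (MachineLabel c)) := by
    intro O
    show Turing.TM2.Cfg.mk _ _ _ = _
    congr 1
    funext j
    cases j <;> rfl
  -- Both alphabets are `Bool` itself, so translating a word is mapping the identity over it.
  have hI := (congrArg (initList (c.machine rn rd C)) (List.map_id (encodeSizeDegree p))).trans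
    (hi _)
  have hO := (congrArg (haltList (c.machine rn rd C)) (List.map_id (enc (f p)))).trans (hf _)
  exact (congrArg (fun a => (flip bind (TM2.step (c.machineStmt rn rd C)))^[k] (some a)) hI).trans
    (e.trans (congrArg some hO.symm))

end

end Cmd

/-! ### Arithmetic on registers -/

namespace Memory

variable {R : Type} [DecidableEq R]

@[simp]
theorem reg_set (s : Memory R) (r r' : R) (x : ℕ) :
    (s.set r x).reg r' = if r' = r then x else s.reg r' := by
  simp [set, Function.update_apply]

@[simp]
theorem out_set (s : Memory R) (r : R) (x : ℕ) : (s.set r x).out = s.out := rfl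

omit [DecidableEq R] in
@[simp]
theorem reg_write (s : Memory R) (b : Bool) : (s.write b).reg = s.reg := rfl

omit [DecidableEq R] in
@[simp]
theorem out_write (s : Memory R) (b : Bool) : (s.write b).out = b :: s.out := rfl

@[simp]
theorem set_self (s : Memory R) (r : R) : s.set r (s.reg r) = s := by
  simp [set]

theorem set_eq_self {s : Memory R} {r : R} {x : ℕ} (h : s.reg r = x) : s.set r x = s := by
  subst h; exact s.set_self r

@[simp]
theorem set_set (s : Memory R) (r : R) (x y : ℕ) : (s.set r x).set r y = s.set r y := by
  simp [set]

theorem set_comm (s : Memory R) {r r' : R} (h : r ≠ r') (x y : ℕ) :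
    (s.set r x).set r' y = (s.set r' y).set r x := by
  simp only [set, Function.update_comm h]

end Memory

namespace Cmd

variable {R : Type} [DecidableEq R] {W : ℕ}

/-- A loop cannot be left early. Early exit is simulated by a body that acts as the identity once
the work is done, so only the first A passes matter. -/
theorem run_loop_of {c : Cmd R} {s : Memory R} (F : ℕ → Memory R) (A : ℕ) (hA : A ≤ W)
    (h0 : F 0 = s) (hF : ∀ i < A, c.run W (F i) = F (i + 1)) (hfix : c.run W (F A) = F A) :
    (loop c).run W s = F A := by
  have h1 : ∀ i ≤ A, (c.run W)^[i] s = F i := by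
    intro i
    induction i with
    | zero => intro _; exact h0.symm
    | succ i ih =>
      intro hi
      rw [Function.iterate_succ_apply', ih (by omega), hF i (by omega)]
  show (c.run W)^[W] s = F A
  obtain ⟨k, rfl⟩ := Nat.exists_eq_add_of_le' hA
  rw [Function.iterate_add_apply, h1 A le_rfl]
  exact Function.iterate_fixed hfix k

/-- Run `c` as often as the register `r` says, counting `r` down. -/
def countdown (r : R) (c : Cmd R) : Cmd R :=
  loop (ifz r skip (seq (dec r) c))

/-- An invariant rule for `countdown`. -/
theorem countdown_rule {c : Cmd R} {r : R} (P : ℕ → Memory R → Prop) {A : ℕ} (hA : A ≤ W)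
    (hr : ∀ k s, P k s → s.reg r = k)
    (hc : ∀ k < A, ∀ s, P (k + 1) s → P k (c.run W (s.set r k))) {s : Memory R} (hs : P A s) :
    P 0 ((countdown r c).run W s) := by
  have key : ∀ i, P (A - i) ((fun s => run W (ifz r skip (seq (dec r) c)) s)^[i] s) := by
    intro i
    induction i with
    | zero => exact hs
    | succ i ih =>
      rw [Function.iterate_succ_apply']
      set s' := (fun s => run W (ifz r skip (seq (dec r) c)) s)^[i] s
      have hr' := hr _ _ ih
      by_cases h : A - i = 0
      · simp only [run]
        rw [if_pos (by rw [hr', h]), show A - (i + 1) = A - i by omega]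
        exact ih
      · simp only [run]
        rw [if_neg (by rw [hr']; exact h)]
        have h2 := hc (A - i - 1) (by omega) s' (by rwa [Nat.sub_add_cancel (by omega)])
        rw [hr', show A - (i + 1) = A - i - 1 by omega]
        exact h2
  have := key W
  rwa [Nat.sub_eq_zero_of_le hA] at this

/-- Run `c` as often as the register `r` says, using `b` to restore `r` afterwards. -/
def forEach (r b : R) (c : Cmd R) : Cmd R :=
  seq (countdown r (seq (inc b) c)) (countdown b (inc r))

/-- Hypothesis `hc` says that along the iterates from `s` the body is indifferent to the contents of
`r` and `b`, which hold the passes left and the passes done while the loop runs. -/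
theorem run_forEach {c : Cmd R} {r b : R} {s : Memory R} (hrb : r ≠ b) (hb : s.reg b = 0)
    (hr : s.reg r ≤ W)
    (hc : ∀ i x y, c.run W ((((c.run W)^[i] s).set r x).set b y)
      = (((c.run W)^[i + 1] s).set r x).set b y) :
    (forEach r b c).run W s = (c.run W)^[s.reg r] s := by
  set A := s.reg r with hA
  have hfix : ∀ i, ((c.run W)^[i] s).reg r = A ∧ ((c.run W)^[i] s).reg b = 0 := by
    intro i
    induction i with
    | zero => exact ⟨rfl, hb⟩
    | succ i ih =>
      rw [Function.iterate_succ_apply']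
      -- Overwriting `r` and `b` with the values they already have changes nothing, so `hc` shows
      -- that the body preserves both.
      have h := hc i A 0
      rw [Memory.set_eq_self ih.1, Memory.set_eq_self ih.2, Function.iterate_succ_apply'] at h
      rw [h]
      simp [hrb]
  show (countdown b (inc r)).run W ((countdown r (seq (inc b) c)).run W s) = _
  have h1 : (countdown r (seq (inc b) c)).run W s
      = (((c.run W)^[A] s).set r 0).set b A := by
    have := countdown_rule (c := seq (inc b) c) (r := r) (W := W) (A := A)
      (fun k s' => k ≤ A ∧ s' = (((c.run W)^[A - k] s).set r k).set b (A - k)) hr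
      (fun k s' h => by simp [h.2, hrb]) ?_ (s := s) ?_
    · simpa using this.2
    · rintro k hk s' ⟨_, rfl⟩
      refine ⟨by omega, ?_⟩
      rw [Memory.set_comm _ hrb.symm, Memory.set_set]
      simp only [run, Memory.reg_set, if_true, Memory.set_set]
      rw [hc, show A - k = A - (k + 1) + 1 by omega]
    · refine ⟨le_rfl, ?_⟩
      simp only [Nat.sub_self, Function.iterate_zero, id]
      rw [Memory.set_eq_self hA.symm, Memory.set_eq_self hb]
  rw [h1]
  have := countdown_rule (c := inc r) (r := b) (W := W) (A := A)
      (fun k s' => k ≤ A ∧ s' = (((c.run W)^[A] s).set r (A - k)).set b k) hr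
      (fun k s' h => by simp [h.2]) ?_ (s := (((c.run W)^[A] s).set r 0).set b A) ?_
  · rw [this.2, Nat.sub_zero, Memory.set_eq_self (hfix A).1, Memory.set_eq_self (hfix A).2]
  · rintro k hk s' ⟨_, rfl⟩
    refine ⟨by omega, ?_⟩
    simp only [run, Memory.reg_set, if_neg hrb, if_true, Memory.set_set]
    rw [Memory.set_comm _ hrb.symm, Memory.set_set, show A - (k + 1) + 1 = A - k by omega]
  · exact ⟨le_rfl, by simp⟩

/-- Set the register `t` to zero. -/
def clear (t : R) : Cmd R :=
  loop (dec t)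

theorem run_clear {t : R} {s : Memory R} (ht : s.reg t ≤ W) :
    (clear t).run W s = s.set t 0 := by
  refine (run_loop_of (fun i => s.set t (s.reg t - i)) (s.reg t) ht (by simp) ?_ ?_).trans
    (by simp)
  · intro i _
    simp [run, Nat.sub_sub]
  · simp [run]

/-- Add the register `r` to the register `t`. -/
def addTo (t r b : R) : Cmd R :=
  forEach r b (inc t)

theorem run_addTo {t r b : R} {s : Memory R} (htr : t ≠ r) (htb : t ≠ b) (hrb : r ≠ b)
    (hb : s.reg b = 0) (hr : s.reg r ≤ W) :
    (addTo t r b).run W s = s.set t (s.reg t + s.reg r) := by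
  rw [addTo, run_forEach hrb hb hr]
  · generalize s.reg r = i
    induction i with
    | zero => simp
    | succ i ih => rw [Function.iterate_succ_apply', ih]; simp [run, Nat.add_assoc]
  · intro i x y
    rw [Function.iterate_succ_apply']
    simp only [run, Memory.reg_set, if_neg htr, if_neg htb]
    rw [Memory.set_comm _ htb.symm, Memory.set_comm _ htr.symm]

/-- Subtract the register `r` from the register `t`. -/
def subFrom (t r b : R) : Cmd R :=
  forEach r b (dec t)

theorem run_subFrom {t r b : R} {s : Memory R} (htr : t ≠ r) (htb : t ≠ b) (hrb : r ≠ b)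
    (hb : s.reg b = 0) (hr : s.reg r ≤ W) :
    (subFrom t r b).run W s = s.set t (s.reg t - s.reg r) := by
  rw [subFrom, run_forEach hrb hb hr]
  · generalize s.reg r = i
    induction i with
    | zero => simp
    | succ i ih => rw [Function.iterate_succ_apply', ih]; simp [run, Nat.sub_sub]
  · intro i x y
    rw [Function.iterate_succ_apply']
    simp only [run, Memory.reg_set, if_neg htr, if_neg htb]
    rw [Memory.set_comm _ htb.symm, Memory.set_comm _ htr.symm]

/-- Add the product of the registers `p` and `r` to the register `t`. -/
def mulAddTo (t p r a b : R) : Cmd R :=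
  forEach p a (addTo t r b)

theorem run_mulAddTo {t p r a b : R} {s : Memory R} (htp : t ≠ p) (htr : t ≠ r) (hta : t ≠ a)
    (htb : t ≠ b) (hpr : p ≠ r) (hpa : p ≠ a) (hpb : p ≠ b) (hra : r ≠ a) (hrb : r ≠ b)
    (hab : a ≠ b) (ha : s.reg a = 0) (hb : s.reg b = 0) (hp : s.reg p ≤ W) (hr : s.reg r ≤ W) :
    (mulAddTo t p r a b).run W s = s.set t (s.reg t + s.reg p * s.reg r) := by
  have key : ∀ i, ((addTo t r b).run W)^[i] s = s.set t (s.reg t + i * s.reg r) := by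
    intro i
    induction i with
    | zero => simp
    | succ i ih =>
      rw [Function.iterate_succ_apply', ih, run_addTo htr htb hrb (by simp [htb.symm, hb])
        (by simpa [htr.symm] using hr)]
      simp [htr.symm, Nat.add_assoc, Nat.add_mul]
  rw [mulAddTo, run_forEach hpa ha hp, key]
  intro i x y
  rw [key, key, run_addTo htr htb hrb (by simp [htb.symm, hpb.symm, hab.symm, hb])
    (by simpa [htr.symm, hpr.symm, hra] using hr)]
  simp only [Memory.reg_set, if_neg htr.symm, if_neg hpr.symm, if_neg hra, if_true,
    if_neg htp, if_neg hta]
  rw [Memory.set_comm _ hta.symm, Memory.set_comm _ htp.symm, Memory.set_set, Nat.add_assoc,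
    Nat.add_mul, Nat.one_mul]

/-- Decrease the register `t` by `k`. -/
def decBy (t : R) : ℕ → Cmd R
  | 0 => skip
  | k + 1 => seq (dec t) (decBy t k)

theorem run_decBy (t : R) (k : ℕ) (s : Memory R) :
    (decBy t k).run W s = s.set t (s.reg t - k) := by
  induction k generalizing s with
  | zero => simp [decBy, run]
  | succ k ih => simp [decBy, run, ih, Nat.sub_sub, Nat.add_comm]

/-- Increase the register `t` by `k`. -/
def incBy (t : R) : ℕ → Cmd R
  | 0 => skip
  | k + 1 => seq (inc t) (incBy t k)

theorem run_incBy (t : R) (k : ℕ) (s : Memory R) :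
    (incBy t k).run W s = s.set t (s.reg t + k) := by
  induction k generalizing s with
  | zero => simp [incBy, run]
  | succ k ih => simp [incBy, run, ih, Nat.add_assoc, Nat.add_comm]

/-- Divide the register `y` by the register `r`: the quotient is added to `x`, and the remainder
is left in `y`. -/
def divMod (x y r t b : R) : Cmd R :=
  loop (seq (addTo t y b) (seq (inc t) (seq (subFrom t r b)
    (ifz t skip (seq (clear t) (seq (subFrom y r b) (inc x)))))))

theorem run_divMod {x y r t b : R} {s : Memory R} (hxy : x ≠ y) (hxr : x ≠ r) (hxt : x ≠ t)
    (hxb : x ≠ b) (hyr : y ≠ r) (hyt : y ≠ t) (hyb : y ≠ b) (hrt : r ≠ t) (hrb : r ≠ b)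
    (htb : t ≠ b) (ht : s.reg t = 0) (hb : s.reg b = 0) (hy : s.reg y ≤ W) (hr : s.reg r ≤ W)
    (hr0 : 0 < s.reg r) :
    (divMod x y r t b).run W s
      = (s.set x (s.reg x + s.reg y / s.reg r)).set y (s.reg y % s.reg r) := by
  -- Division is repeated subtraction. The test register holds y + 1 - r, truncated, which is
  -- nonzero exactly when r ≤ y.
  have hbody : ∀ s : Memory R, s.reg t = 0 → s.reg b = 0 → s.reg y ≤ W → s.reg r ≤ W →
      0 < s.reg r → run W (seq (addTo t y b) (seq (inc t) (seq (subFrom t r b)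
        (ifz t skip (seq (clear t) (seq (subFrom y r b) (inc x))))))) s
        = if s.reg r ≤ s.reg y then (s.set x (s.reg x + 1)).set y (s.reg y - s.reg r)
          else s := by
    intro s ht hb hy hr hr0
    rw [run, run_addTo hyt.symm htb hyb hb hy, run, run, run, run_subFrom hrt.symm htb hrb
      (by simp [htb.symm, hb]) (by simpa [hrt] using hr), run]
    simp only [Memory.set_set, Memory.reg_set, if_true, if_neg hrt, ht]
    split_ifs with h1 h2 h2
    · omega
    · rw [run]; exact Memory.set_eq_self (by omega)
    · rw [run, run_clear (by simp; omega), run, run_subFrom hyr hyb hrb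
        (by simp [htb.symm, hb]) (by simpa [hrt] using hr), run]
      simp only [Memory.set_set, Memory.reg_set, if_neg hrt, if_neg hyt, if_neg hxy,
        if_neg hxt]
      rw [Memory.set_eq_self ht, Memory.set_comm _ hxy.symm]
    · omega
  have key : ∀ k, ∀ s : Memory R, s.reg t = 0 → s.reg b = 0 → s.reg y ≤ W → s.reg r ≤ W →
      0 < s.reg r → s.reg y / s.reg r ≤ k →
      (run W (seq (addTo t y b) (seq (inc t) (seq (subFrom t r b)
        (ifz t skip (seq (clear t) (seq (subFrom y r b) (inc x))))))))^[k] s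
        = (s.set x (s.reg x + s.reg y / s.reg r)).set y (s.reg y % s.reg r) := by
    intro k
    induction k with
    | zero =>
      intro s ht hb hy hr hr0 hk
      have hlt : s.reg y < s.reg r := by
        rcases Nat.div_eq_zero_iff.1 (Nat.le_zero.1 hk) with h | h <;> omega
      rw [Nat.div_eq_of_lt hlt, Nat.mod_eq_of_lt hlt, Nat.add_zero, Memory.set_self,
        Memory.set_self]
      rfl
    | succ k ih =>
      intro s ht hb hy hr hr0 hk
      rw [Function.iterate_succ_apply, hbody s ht hb hy hr hr0]
      split_ifs with h
      · have hd := Nat.div_eq_sub_div hr0 h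
        have hm := Nat.mod_eq_sub_mod h
        rw [ih]
        · simp only [Memory.reg_set, if_true, if_neg hxy, if_neg hxr.symm, if_neg hyr.symm]
          rw [Memory.set_comm _ hxy.symm, Memory.set_set, Memory.set_set, hd, hm]
          congr 2; omega
        · simp [hxt.symm, hyt.symm, ht]
        · simp [hxb.symm, hyb.symm, hb]
        · simp; omega
        · simpa [hxr.symm, hyr.symm] using hr
        · simpa [hxr.symm, hyr.symm] using hr0
        · simp [hxr.symm, hyr.symm]; omega
      · refine ih s ht hb hy hr hr0 ?_
        rw [Nat.div_eq_of_lt (by omega)]; omega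
  exact key W s ht hb hy hr hr0 ((Nat.div_le_self _ _).trans hy)

end Cmd

/-! ### The graph on n vertices obtained by folding a torus -/

/-- The eight moves on the torus `(ℤ/m)²`, whose points are given by representatives: the shear
`(x, y) ↦ (x + y, y)`, the shift `(x, y) ↦ (x + 1, y)`, their inverses, the swap of coordinates,
and three times the identity. -/
def torusMove (m g x y : ℕ) : ℕ × ℕ :=
  match g with
  | 0 => ((x + y) % m, y)
  | 1 => ((x + m - y) % m, y)
  | 2 => ((x + 1) % m, y)
  | 3 => ((x + m - 1) % m, y)
  | 4 => (y, x)
  | _ => (x, y)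

/-- The side length of the torus used for `n` vertices. -/
def torusSide (n : ℕ) : ℕ :=
  Nat.find (⟨n, Nat.le_mul_self n⟩ : ∃ m, n ≤ m * m)

theorem le_torusSide_mul_self (n : ℕ) : n ≤ torusSide n * torusSide n :=
  Nat.find_spec (⟨n, Nat.le_mul_self n⟩ : ∃ m, n ≤ m * m)

theorem mul_self_lt_of_lt_torusSide {n i : ℕ} (hi : i < torusSide n) : i * i < n :=
  not_le.1 (Nat.find_min (⟨n, Nat.le_mul_self n⟩ : ∃ m, n ≤ m * m) hi)

/-- Since n ≤ m² every vertex represents a point of the torus; by this bound it represents at most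
two, with indices z and z + n. Hence two groups of eight labels suffice. -/
theorem torusSide_mul_self_le (n : ℕ) : torusSide n * torusSide n ≤ 2 * n := by
  rcases h : torusSide n with _ | k
  · simp
  · have := mul_self_lt_of_lt_torusSide (n := n) (i := k) (by omega)
    rcases k with _ | _ | k
    · omega
    · omega
    · nlinarith

theorem torusSide_le (n : ℕ) : torusSide n ≤ n :=
  Nat.find_min' _ (Nat.le_mul_self n)

theorem torusSide_pos {n : ℕ} (hn : 0 < n) : 0 < torusSide n := by
  rcases Nat.eq_zero_or_pos (torusSide n) with h | h
  · have := le_torusSide_mul_self n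
    rw [h] at this; omega
  · exact h

/-- The vertex represented by a point of the torus with the given index. -/
def foldIndex (n i : ℕ) : ℕ :=
  if i < n then i else i - n

/-- The point of the torus, as an index, at which the edge with label `e` leaves the vertex `z`. -/
def startIndex (n e z : ℕ) : ℕ :=
  if 8 ≤ e then z + n else z

/-- The end of the edge with label `e` that starts at the vertex `z`. -/
def vertexStep (n e z : ℕ) : ℕ :=
  let m := torusSide n
  let p := startIndex n e z
  if p < m * m then
    let xy := torusMove m (e % 8) (p / m) (p % m)
    foldIndex n (xy.1 * m + xy.2)
  else z

/-- The end of the walk of length `k` that starts at the vertex `z` and follows the labels given by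
the base `16` digits of `w`. -/
def vertexWalk (n : ℕ) : ℕ → ℕ → ℕ → ℕ
  | 0, z, _ => z
  | k + 1, z, w => vertexWalk n k (vertexStep n (w % 16) z) (w / 16)

/-! ### The program that writes the tables of multiplicities -/

/-- The registers of the program that writes down the graphs. -/
inductive Reg : Type
  | size | degree | side | area | base | u | v | w | z | q | r | x | y | c | e | t | a | b
  deriving DecidableEq

instance : Fintype Reg :=
  Fintype.ofList [.size, .degree, .side, .area, .base, .u, .v, .w, .z, .q, .r, .x, .y, .c, .e, .t,
    .a, .b] fun i => by cases i <;> decide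

namespace Cmd

open Reg

variable {W : ℕ}

/-- Put the index of the point at which the edge with label `e` leaves `z` into `y`. -/
def pointCmd : Cmd Reg :=
  seq (addTo y z b) (seq (addTo c e b) (seq (decBy c 7)
    (ifz c skip (seq (clear c) (seq (addTo y size b) (decBy e 8))))))

/-- Subtracting 7 from a copy of the label leaves zero exactly for labels below 8, which decides
whether the edge leaves from z or from z + n. -/
theorem run_pointCmd {s : Memory Reg} (hy : s.reg y = 0) (hc : s.reg c = 0) (hb : s.reg b = 0)
    (hz : s.reg z ≤ W) (he : s.reg e < 16) (he' : s.reg e ≤ W) (hsize : s.reg size ≤ W) :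
    pointCmd.run W s = (s.set y (startIndex (s.reg size) (s.reg e) (s.reg z))).set e
      (s.reg e % 8) := by
  have h7 : s.reg e - 7 ≤ W := by omega
  rw [pointCmd]
  simp only [run]
  rw [run_addTo (by decide) (by decide) (by decide) hb hz,
    run_addTo (by decide) (by decide) (by decide) (by simpa using hb) (by simpa using he'),
    run_decBy]
  simp only [Memory.reg_set, Memory.set_set, hy, hc, Nat.zero_add, if_true, reduceCtorEq,
    if_false]
  by_cases h : 8 ≤ s.reg e
  · rw [if_neg (by omega), run_clear (by simpa using h7),
      run_addTo (by decide) (by decide) (by decide) (by simpa using hb) (by simpa using hsize),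
      run_decBy, startIndex, if_pos h, show s.reg e % 8 = s.reg e - 8 by omega]
    ext i <;> cases i <;> simp [hc]
  · rw [if_pos (by omega), startIndex, if_neg h, show s.reg e % 8 = s.reg e by omega]
    ext i <;> cases i <;> simp [hc]; omega

/-- Swap the registers `x` and `y`. -/
def swapCmd : Cmd Reg :=
  seq (addTo t x b) (seq (clear x) (seq (addTo x y b) (seq (clear y) (seq (addTo y t b)
    (clear t)))))

theorem run_swapCmd {s : Memory Reg} (ht : s.reg t = 0) (hb : s.reg b = 0) (hx : s.reg x ≤ W)
    (hy : s.reg y ≤ W) : swapCmd.run W s = (s.set x (s.reg y)).set y (s.reg x) := by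
  rw [swapCmd, run, run_addTo (by decide) (by decide) (by decide) hb hx,
    run, run_clear (by simpa using hx),
    run, run_addTo (by decide) (by decide) (by decide) (by simpa using hb) (by simpa using hy),
    run, run_clear (by simpa using hy),
    run, run_addTo (by decide) (by decide) (by decide) (by simpa using hb) (by simpa [ht] using hx),
    run_clear (by simpa [ht] using hx)]
  ext i <;> cases i <;> simp [ht]

/-- Reduce the register `x` modulo the register `side`. -/
def reduceCmd : Cmd Reg :=
  seq (divMod c x side t b) (clear c)

theorem run_reduceCmd {s : Memory Reg} (hc : s.reg c = 0) (ht : s.reg t = 0) (hb : s.reg b = 0)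
    (hx : s.reg x ≤ W) (hside : s.reg side ≤ W) (hpos : 0 < s.reg side) :
    reduceCmd.run W s = s.set x (s.reg x % s.reg side) := by
  rw [reduceCmd, run, run_divMod (by decide) (by decide) (by decide) (by decide) (by decide)
    (by decide) (by decide) (by decide) (by decide) (by decide) ht hb hx hside hpos, run_clear]
  · ext i <;> cases i <;> simp [hc]
  · simp only [Memory.reg_set, reduceCtorEq, if_false, if_true, hc, Nat.zero_add]
    exact (Nat.div_le_self _ _).trans hx

/-- Apply the move with number `e` to the point `(x, y)` of the torus. -/
def moveCmd : Cmd Reg :=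
  seq
    (ifz e (addTo x y b) (seq (dec e)
    (ifz e (seq (addTo x side b) (subFrom x y b)) (seq (dec e)
    (ifz e (inc x) (seq (dec e)
    (ifz e (seq (addTo x side b) (dec x)) (seq (dec e)
    (ifz e swapCmd (clear e))))))))))
    reduceCmd

theorem run_moveCmd {s : Memory Reg} (hc : s.reg c = 0) (ht : s.reg t = 0) (hb : s.reg b = 0)
    (hx : s.reg x < s.reg side) (hy : s.reg y < s.reg side) (he : s.reg e ≤ W)
    (hside : 2 * s.reg side ≤ W) :
    moveCmd.run W s = ((s.set x (torusMove (s.reg side) (s.reg e) (s.reg x) (s.reg y)).1).set y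
      (torusMove (s.reg side) (s.reg e) (s.reg x) (s.reg y)).2).set e 0 := by
  have hxW : s.reg x ≤ W := by omega
  have hyW : s.reg y ≤ W := by omega
  have hsW : s.reg side ≤ W := by omega
  -- The reduction modulo the side is done after every move; after the swap and the identity it
  -- changes nothing, as the coordinates are already small.
  have hfin : ∀ s' : Memory Reg, s'.reg c = 0 → s'.reg t = 0 → s'.reg b = 0 → s'.reg x ≤ W →
      s'.reg side = s.reg side →
      reduceCmd.run W s' = s'.set x (s'.reg x % s.reg side) := by
    intro s' hc' ht' hb' hx' hs'
    rw [run_reduceCmd hc' ht' hb' hx' (by omega) (by omega), hs']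
  rw [moveCmd, run]
  rcases hg : s.reg e with _ | _ | _ | _ | _ | g
  · simp only [run, hg, if_true, torusMove]
    rw [run_addTo (by decide) (by decide) (by decide) hb hyW]
    refine (hfin _ ?_ ?_ ?_ ?_ ?_).trans ?_
    any_goals (simp [*]; done)
    · simp; omega
    · ext i <;> cases i <;> simp [hg]
  · simp only [run, hg, Memory.reg_set, if_true, torusMove, Nat.add_one_ne_zero, if_false,
      Nat.zero_add, Nat.sub_self]
    rw [run_addTo (by decide) (by decide) (by decide) (by simpa using hb) (by simpa using hsW),
      run_subFrom (by decide) (by decide) (by decide) (by simpa using hb) (by simpa using hyW)]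
    refine (hfin _ ?_ ?_ ?_ ?_ ?_).trans ?_
    any_goals (simp [*]; done)
    · simp; omega
    · ext i <;> cases i <;> simp
  · simp only [run, hg, Memory.reg_set, if_true, torusMove, Nat.add_one_ne_zero, if_false,
      Nat.zero_add, Nat.sub_self, Nat.add_sub_cancel]
    refine (hfin _ ?_ ?_ ?_ ?_ ?_).trans ?_
    any_goals (simp [*]; done)
    · simp; omega
    · ext i <;> cases i <;> simp
  · simp only [run, hg, Memory.reg_set, if_true, torusMove, Nat.add_one_ne_zero, if_false,
      Nat.zero_add, Nat.sub_self, Nat.add_sub_cancel]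
    rw [run_addTo (by decide) (by decide) (by decide) (by simpa using hb) (by simpa using hsW)]
    refine (hfin _ ?_ ?_ ?_ ?_ ?_).trans ?_
    any_goals (simp [*]; done)
    · simp; omega
    · ext i <;> cases i <;> simp
  · simp only [run, hg, Memory.reg_set, if_true, torusMove, Nat.add_one_ne_zero, if_false,
      Nat.zero_add, Nat.sub_self, Nat.add_sub_cancel]
    rw [run_swapCmd (by simpa using ht) (by simpa using hb) (by simpa using hxW)
      (by simpa using hyW)]
    refine (hfin _ ?_ ?_ ?_ ?_ ?_).trans ?_
    any_goals (simp [*]; done)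
    · ext i <;> cases i <;> simp [ht, Nat.mod_eq_of_lt hy]
  · simp only [run, hg, Memory.reg_set, if_true, torusMove, Nat.add_one_ne_zero, if_false,
      Nat.add_sub_cancel]
    rw [run_clear (by simp; omega)]
    refine (hfin _ ?_ ?_ ?_ ?_ ?_).trans ?_
    any_goals (simp [*]; done)
    · ext i <;> cases i <;> simp [Nat.mod_eq_of_lt hx]

/-- Put the vertex represented by the point `(x, y)` of the torus into `z`. -/
def indexCmd : Cmd Reg :=
  seq (clear z) (seq (mulAddTo z x side a b) (seq (addTo z y b) (seq (clear x) (seq (clear y)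
    (seq (addTo c z b) (seq (inc c) (seq (subFrom c size b)
      (ifz c skip (seq (clear c) (subFrom z size b))))))))))

/-- The index i is folded by testing i + 1 - n, truncated, which is zero exactly when i < n. -/
theorem run_indexCmd {s : Memory Reg} (hc : s.reg c = 0) (ha : s.reg a = 0) (hb : s.reg b = 0)
    (hx : s.reg x ≤ W) (hy : s.reg y ≤ W) (hz : s.reg z ≤ W) (hside : s.reg side ≤ W)
    (hsize : s.reg size ≤ W) (hxy : s.reg x * s.reg side + s.reg y + 1 ≤ W) :
    indexCmd.run W s = ((s.set z (foldIndex (s.reg size) (s.reg x * s.reg side + s.reg y))).set x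
      0).set y 0 := by
  set i := s.reg x * s.reg side + s.reg y with hi
  rw [indexCmd, run, run_clear hz, run, run_mulAddTo (by decide) (by decide) (by decide) (by decide)
      (by decide)
      (by decide) (by decide) (by decide) (by decide) (by decide) (by simpa using ha)
      (by simpa using hb) (by simpa using hx) (by simpa using hside),
    run, run_addTo (by decide) (by decide) (by decide) (by simpa using hb) (by simpa using hy),
    run, run_clear (by simpa using hx), run, run_clear (by simpa using hy)]
  simp only [run, Memory.reg_set, Memory.set_set, if_true, reduceCtorEq, if_false, Nat.zero_add]
  rw [← hi]
  rw [run_addTo (by decide) (by decide) (by decide) (by simpa using hb) (by simp; omega)]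
  simp only [Memory.reg_set, Memory.set_set, if_true, reduceCtorEq, if_false, Nat.zero_add, hc]
  rw [run_subFrom (by decide) (by decide) (by decide) (by simpa using hb) (by simpa using hsize)]
  simp only [Memory.reg_set, Memory.set_set, if_true, reduceCtorEq, if_false]
  by_cases h : i < s.reg size
  · rw [if_pos (by omega), foldIndex, if_pos h]
    ext j <;> cases j <;> simp [hc, hi]; omega
  · rw [if_neg (by omega), foldIndex, if_neg h, run_clear (by simp; omega),
      run_subFrom (by decide) (by decide) (by decide) (by simpa using hb) (by simpa using hsize)]
    ext j <;> cases j <;> simp [hc, hi]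

/-- The registers that do not change have the right values, and the auxiliary ones are zero. -/
structure IsTidy (n d : ℕ) (s : Memory Reg) : Prop where
  size : s.reg size = n
  degree : s.reg degree = d
  side : s.reg side = torusSide n
  area : s.reg area = torusSide n * torusSide n
  base : s.reg base = 16
  x : s.reg x = 0
  y : s.reg y = 0
  c : s.reg c = 0
  t : s.reg t = 0
  a : s.reg a = 0
  b : s.reg b = 0

/-- Move from the vertex `z` along the edge with label `e`. -/
def stepCmd : Cmd Reg :=
  seq pointCmd (seq (addTo c area b) (seq (subFrom c y b)
    (ifz c (seq (clear y) (clear e))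
      (seq (clear c) (seq (divMod x y side t b) (seq moveCmd indexCmd))))))

theorem torusMove_lt {m g x y : ℕ} (hx : x < m) (hy : y < m) :
    (torusMove m g x y).1 < m ∧ (torusMove m g x y).2 < m := by
  have hm : 0 < m := by omega
  unfold torusMove
  split <;> simp [Nat.mod_lt _ hm, hx, hy]

theorem mul_add_lt {m x y : ℕ} (hx : x < m) (hy : y < m) : x * m + y < m * m :=
  calc x * m + y < x * m + m := by omega
    _ = (x + 1) * m := by ring
    _ ≤ m * m := Nat.mul_le_mul_right _ hx

/-- The truncated difference of area and index vanishes exactly when the index lies outside the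
torus; the edge is then a loop and z stays. -/
theorem run_stepCmd {n d : ℕ} {s : Memory Reg} (hs : IsTidy n d s) (hW : 4 * n + d + 32 ≤ W)
    (hz : s.reg z < n) (he : s.reg e < 16) :
    stepCmd.run W s = (s.set z (vertexStep n (s.reg e) (s.reg z))).set e 0 := by
  have hsd := torusSide_le n
  have har := torusSide_mul_self_le n
  have hp : startIndex n (s.reg e) (s.reg z) ≤ 2 * n := by
    unfold startIndex; split_ifs <;> omega
  set p := startIndex n (s.reg e) (s.reg z) with hp_def
  set m := torusSide n with hm
  have hside : s.reg side = m := hs.side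
  have harea : s.reg area = m * m := hs.area
  have hm0 : 0 < m := torusSide_pos (by omega)
  rw [stepCmd]
  simp only [run]
  rw [run_pointCmd hs.y hs.c hs.b (by omega) he (by omega) (by rw [hs.size]; omega), hs.size,
    ← hp_def]
  rw [run_addTo (by decide) (by decide) (by decide) (by simpa using hs.b)
    (by simp [harea]; omega)]
  simp only [Memory.reg_set, reduceCtorEq, if_false, Nat.zero_add, hs.c, harea]
  rw [run_subFrom (by decide) (by decide) (by decide) (by simpa using hs.b) (by simp; omega)]
  simp only [Memory.reg_set, Memory.set_set, if_true, reduceCtorEq, if_false]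
  have hstep : vertexStep n (s.reg e) (s.reg z) = if p < m * m then
    foldIndex n ((torusMove m (s.reg e % 8) (p / m) (p % m)).1 * m
      + (torusMove m (s.reg e % 8) (p / m) (p % m)).2) else s.reg z := rfl
  by_cases h : p < m * m
  · rw [if_neg (by omega), run_clear (by simp; omega)]
    have hx : p / m < m := Nat.div_lt_of_lt_mul h
    have hy : p % m < m := Nat.mod_lt _ hm0
    obtain ⟨h1, h2⟩ := torusMove_lt (g := s.reg e % 8) hx hy
    have h3 := mul_add_lt h1 h2
    rw [run_divMod (by decide) (by decide) (by decide) (by decide) (by decide) (by decide)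
      (by decide) (by decide) (by decide) (by decide) (by simpa using hs.t) (by simpa using hs.b)
      (by simp; omega) (by simp [hside]; omega) (by simp [hside]; omega)]
    simp only [Memory.reg_set, Memory.set_set, if_true, reduceCtorEq, if_false, Nat.zero_add,
      hs.x, hside]
    rw [run_moveCmd]
    · simp only [Memory.reg_set, if_true, reduceCtorEq, if_false, hside]
      rw [run_indexCmd]
      · simp only [Memory.reg_set, if_true, reduceCtorEq, if_false, hside,
          hs.size]
        rw [hstep, if_pos h]
        ext i <;> cases i <;> simp [hs.x, hs.y, hs.c]
      all_goals simp [hs.a, hs.b, hs.size, hside]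
      all_goals omega
    · simp
    · simp [hs.t]
    · simp [hs.b]
    · simpa [hside] using hx
    · simpa [hside] using hy
    · simp; omega
    · simp [hside]; omega
  · rw [if_pos (by omega), run_clear (t := y) (by simp; omega), run_clear (by simp; omega), hstep,
      if_neg h]
    ext i <;> cases i <;> simp [hs.y, hs.c]
    omega

end Cmd

theorem foldIndex_lt {n i : ℕ} (hi : i < 2 * n) : foldIndex n i < n := by
  unfold foldIndex; split_ifs <;> omega

theorem vertexStep_lt {n e z : ℕ} (hz : z < n) : vertexStep n e z < n := by
  have hm : 0 < torusSide n := torusSide_pos (by omega)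
  simp only [vertexStep]
  split_ifs with h
  · obtain ⟨h1, h2⟩ := Cmd.torusMove_lt (g := e % 8) (Nat.div_lt_of_lt_mul h) (Nat.mod_lt _ hm)
    exact foldIndex_lt ((Cmd.mul_add_lt h1 h2).trans_le (torusSide_mul_self_le n))
  · exact hz

theorem vertexWalk_lt {n z : ℕ} (hz : z < n) (k w : ℕ) : vertexWalk n k z w < n := by
  induction k generalizing z w with
  | zero => exact hz
  | succ k ih => exact ih (vertexStep_lt hz) _

/-- The definition splits off the first step of a walk, while the program extends a walk at its end.
This is the recursion that the loop invariant follows. -/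
theorem vertexWalk_succ (n k z w : ℕ) :
    vertexWalk n (k + 1) z w = vertexStep n (w / 16 ^ k % 16) (vertexWalk n k z w) := by
  induction k generalizing z w with
  | zero => simp [vertexWalk]
  | succ k ih =>
    rw [vertexWalk, ih, Nat.div_div_eq_div_mul, ← pow_succ']
    rfl

/-- The walks from `u` to `v` whose labels are the digits of a number less than `d`. -/
def IsWalkCode (n d u v w : ℕ) : Prop :=
  w / 16 ^ Nat.log 16 d = 0 ∧ vertexWalk n (Nat.log 16 d) u w = v

instance (n d u v : ℕ) : DecidablePred (IsWalkCode n d u v) := fun _ =>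
  inferInstanceAs (Decidable (_ ∧ _))

/-- The number of walks from `u` to `v` whose labels are the digits of a number less than `d`. -/
def walkCount (n d u v : ℕ) : ℕ :=
  ((Finset.Ico 0 d).filter (IsWalkCode n d u v)).card

namespace Cmd

open Reg

variable {W : ℕ}

/-- Make one step of the walk and remove the last digit of `q` and `r`, unless `r` has just one
digit. -/
def digitCmd : Cmd Reg :=
  seq (addTo y r b) (seq (divMod x y base t b) (seq (clear y)
    (ifz x skip (seq (clear r) (seq (addTo r x b) (seq (clear x) (seq (addTo y q b) (seq (clear q)
      (seq (divMod q y base t b) (seq (addTo e y b) (seq (clear y) stepCmd)))))))))))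

/-- Register `r` is the clock of the walk: it starts at d and loses one digit per step. The body
idles when one digit is left, which yields `Nat.log 16 d` steps without computing a logarithm. -/
theorem run_digitCmd {n d : ℕ} {s : Memory Reg} (hs : IsTidy n d s) (hW : 4 * n + d + 32 ≤ W)
    (he : s.reg e = 0) (hz : s.reg z < n) (hq : s.reg q ≤ W) (hr : s.reg r ≤ W) :
    digitCmd.run W s = if s.reg r / 16 = 0 then s else
      ((s.set z (vertexStep n (s.reg q % 16) (s.reg z))).set q (s.reg q / 16)).set r
        (s.reg r / 16) := by
  have hr16 : s.reg r / 16 ≤ W := (Nat.div_le_self _ _).trans hr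
  have hqm : s.reg q % 16 < 16 := Nat.mod_lt _ (by norm_num)
  have hrm : s.reg r % 16 < 16 := Nat.mod_lt _ (by norm_num)
  rw [digitCmd, run, run_addTo (by decide) (by decide) (by decide) hs.b hr,
    run, run_divMod (by decide) (by decide) (by decide) (by decide) (by decide) (by decide)
      (by decide) (by decide) (by decide) (by decide) (by simpa using hs.t) (by simpa using hs.b)
      (by simpa [hs.y] using hr) (by simp [hs.base]; omega) (by simp [hs.base]),
    run, run_clear (by simp [hs.base, hs.y]; omega), run]
  simp only [Memory.reg_set, Memory.set_set, if_true, reduceCtorEq, if_false, Nat.zero_add,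
    hs.x, hs.y, hs.base]
  split_ifs with h
  · rw [run]
    ext i <;> cases i <;> simp [hs.x, hs.y, h]
  · rw [run, run_clear (t := r) (by simpa using hr),
      run, run_addTo (by decide) (by decide) (by decide) (by simpa using hs.b)
        (by simpa using hr16),
      run, run_clear (t := x) (by simpa using hr16),
      run, run_addTo (by decide) (by decide) (by decide) (by simpa using hs.b) (by simpa using hq),
      run, run_clear (t := q) (by simpa using hq),
      run, run_divMod (by decide) (by decide) (by decide) (by decide) (by decide) (by decide)
        (by decide) (by decide) (by decide) (by decide) (by simpa using hs.t)
        (by simpa using hs.b) (by simpa using hq) (by simp [hs.base]; omega) (by simp [hs.base]),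
      run, run_addTo (by decide) (by decide) (by decide) (by simpa using hs.b)
        (by simp [hs.base]; omega),
      run, run_clear (t := y) (by simp [hs.base]; omega)]
    rw [run_stepCmd (n := n) (d := d)]
    · ext i <;> cases i <;> simp [hs.x, hs.y, hs.base, he]
    · constructor <;> simp [hs.size, hs.degree, hs.side, hs.area, hs.base, hs.c, hs.t, hs.a, hs.b]
    · exact hW
    · simpa using hz
    · simpa [hs.base, he] using hqm

/-- A memory between two walks. -/
structure IsIdle (n d : ℕ) (s : Memory Reg) : Prop extends IsTidy n d s where
  e : s.reg e = 0
  z : s.reg z = 0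
  q : s.reg q = 0
  r : s.reg r = 0

/-- Follow the walk that starts at `u` and whose labels are the digits of `w`. -/
def walkCmd : Cmd Reg :=
  seq (addTo z u b) (seq (addTo q w b) (seq (addTo r degree b) (loop digitCmd)))

theorem run_walkCmd {n d : ℕ} {s : Memory Reg} (hs : IsIdle n d s) (hW : 4 * n + d + 32 ≤ W)
    (hu : s.reg u < n) (hw : s.reg w ≤ W) :
    walkCmd.run W s = ((s.set z (vertexWalk n (Nat.log 16 d) (s.reg u) (s.reg w))).set q
      (s.reg w / 16 ^ Nat.log 16 d)).set r (d / 16 ^ Nat.log 16 d) := by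
  rw [walkCmd, run, run_addTo (by decide) (by decide) (by decide) hs.b (by omega),
    run, run_addTo (by decide) (by decide) (by decide) (by simpa using hs.b) (by simpa using hw),
    run, run_addTo (by decide) (by decide) (by decide) (by simpa using hs.b)
      (by simp [hs.degree]; omega)]
  simp only [Memory.reg_set, reduceCtorEq, if_false, Nat.zero_add,
    hs.z, hs.q, hs.r, hs.degree]
  have hF : ∀ i, digitCmd.run W (((s.set z (vertexWalk n i (s.reg u) (s.reg w))).set q
      (s.reg w / 16 ^ i)).set r (d / 16 ^ i)) = if d / 16 ^ (i + 1) = 0 then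
        (((s.set z (vertexWalk n i (s.reg u) (s.reg w))).set q
          (s.reg w / 16 ^ i)).set r (d / 16 ^ i)) else
        (((s.set z (vertexWalk n (i + 1) (s.reg u) (s.reg w))).set q
          (s.reg w / 16 ^ (i + 1))).set r (d / 16 ^ (i + 1))) := by
    intro i
    rw [run_digitCmd (n := n) (d := d) _ hW]
    · simp only [Memory.reg_set, if_true, reduceCtorEq, if_false, Nat.div_div_eq_div_mul,
        ← pow_succ, vertexWalk_succ]
      split_ifs
      · rfl
      · ext i <;> cases i <;> simp
    · simpa using hs.e
    · simpa using vertexWalk_lt hu _ _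
    · simpa using (Nat.div_le_self _ _).trans hw
    · simpa using (Nat.div_le_self _ _).trans (by omega)
    · constructor <;> simp [hs.size, hs.degree, hs.side, hs.area, hs.base, hs.x, hs.y, hs.c, hs.t,
        hs.a, hs.b]
  refine run_loop_of (fun i => ((s.set z (vertexWalk n i (s.reg u) (s.reg w))).set q
    (s.reg w / 16 ^ i)).set r (d / 16 ^ i)) (Nat.log 16 d)
    ((Nat.log_le_self _ _).trans (by omega)) ?_ ?_ ?_
  · simp [vertexWalk]
  · intro i hi
    rw [hF, if_neg]
    have hd : d ≠ 0 := by rintro rfl; simp at hi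
    have h1 : 16 ^ (i + 1) ≤ d := Nat.pow_le_of_le_log hd hi
    exact (Nat.div_pos h1 (by positivity)).ne'
  · rw [hF, if_pos]
    exact Nat.div_eq_of_lt (Nat.lt_pow_succ_log_self (by norm_num) d)

/-- Write a one if the walk has ended at `v` and no digits of `w` are left. -/
def checkCmd : Cmd Reg :=
  ifz q (seq (addTo c z b) (seq (subFrom c v b) (seq (addTo x v b) (seq (subFrom x z b)
    (seq (addTo c x b) (seq (clear x) (ifz c (emit true) (clear c)))))))) skip

/-- Equality is tested by (z - v) + (v - z) with truncated subtraction, which is zero exactly when z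
= v. -/
theorem run_checkCmd {s : Memory Reg} (hc : s.reg c = 0) (hx : s.reg x = 0) (hb : s.reg b = 0)
    (hz : s.reg z ≤ W) (hv : s.reg v ≤ W) :
    checkCmd.run W s = if s.reg q = 0 ∧ s.reg z = s.reg v then s.write true else s := by
  rw [checkCmd, run]
  by_cases hq : s.reg q = 0
  · rw [if_pos hq, run, run_addTo (by decide) (by decide) (by decide) hb hz,
      run, run_subFrom (by decide) (by decide) (by decide) (by simpa using hb) (by simpa using hv),
      run, run_addTo (by decide) (by decide) (by decide) (by simpa using hb) (by simpa using hv),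
      run, run_subFrom (by decide) (by decide) (by decide) (by simpa using hb) (by simpa using hz),
      run, run_addTo (by decide) (by decide) (by decide) (by simpa using hb)
        (by simp [hx]; omega),
      run, run_clear (by simp [hx]; omega)]
    simp only [run, Memory.reg_set, Memory.set_set, if_true, reduceCtorEq, if_false, Nat.zero_add,
      hc, hx, hq, true_and]
    by_cases h : s.reg z = s.reg v
    · rw [if_pos (by omega), if_pos h]
      ext i
      · cases i <;> simp [hc, hx, h]
      · simp
    · rw [if_neg (by omega), if_neg h, run_clear (by simp; omega)]
      ext i <;> cases i <;> simp [hc, hx]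
  · rw [if_neg hq, if_neg (by tauto), run]

/-- Write a one if the digits of `w` describe a walk from `u` to `v`. -/
def codeCmd : Cmd Reg :=
  seq walkCmd (seq checkCmd (seq (clear z) (seq (clear q) (clear r))))

theorem run_codeCmd {n d : ℕ} {s : Memory Reg} (hs : IsIdle n d s) (hW : 4 * n + d + 32 ≤ W)
    (hu : s.reg u < n) (hv : s.reg v < n) (hw : s.reg w ≤ W) :
    codeCmd.run W s = if IsWalkCode n d (s.reg u) (s.reg v) (s.reg w) then s.write true
      else s := by
  have h1 := vertexWalk_lt hu (Nat.log 16 d) (s.reg w)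
  have h2 : s.reg w / 16 ^ Nat.log 16 d ≤ W := (Nat.div_le_self _ _).trans hw
  have h3 : d / 16 ^ Nat.log 16 d ≤ W := (Nat.div_le_self _ _).trans (by omega)
  rw [codeCmd, run, run_walkCmd hs hW hu hw, run,
    run_checkCmd (by simpa using hs.c) (by simpa using hs.x) (by simpa using hs.b)
      (by simp; omega) (by simp; omega)]
  simp only [Memory.reg_set, if_true, reduceCtorEq, if_false]
  have hzq : ∀ s' : Memory Reg, s'.reg z ≤ W → s'.reg q ≤ W → s'.reg r ≤ W →
      run W (seq (clear z) (seq (clear q) (clear r))) s' = ((s'.set z 0).set q 0).set r 0 := by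
    intro s' hz hq hr
    rw [run, run_clear hz, run, run_clear (t := q) (by simpa using hq),
      run_clear (by simpa using hr)]
  have hdef : IsWalkCode n d (s.reg u) (s.reg v) (s.reg w) ↔ s.reg w / 16 ^ Nat.log 16 d = 0 ∧
      vertexWalk n (Nat.log 16 d) (s.reg u) (s.reg w) = s.reg v := Iff.rfl
  by_cases h : s.reg w / 16 ^ Nat.log 16 d = 0 ∧
      vertexWalk n (Nat.log 16 d) (s.reg u) (s.reg w) = s.reg v
  · rw [if_pos h, if_pos (hdef.2 h), hzq _ (by simp; omega) (by simpa using h2)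
      (by simpa using h3)]
    ext i
    · cases i <;> simp [hs.z, hs.q, hs.r]
    · simp
  · rw [if_neg h, if_neg (mt hdef.1 h), hzq _ (by simp; omega) (by simpa using h2)
      (by simpa using h3)]
    ext i
    · cases i <;> simp [hs.z, hs.q, hs.r]
    · simp

theorem IsIdle.set {n d : ℕ} {s : Memory Reg} (hs : IsIdle n d s) {i : Reg}
    (hi : i = u ∨ i = v ∨ i = w) (k : ℕ) : IsIdle n d (s.set i k) := by
  obtain ⟨⟨h1, h2, h3, h4, h5, h6, h7, h8, h9, h10, h11⟩, h12, h13, h14, h15⟩ := hs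
  rcases hi with rfl | rfl | rfl <;> refine ⟨⟨?_, ?_, ?_, ?_, ?_, ?_, ?_, ?_, ?_, ?_, ?_⟩, ?_, ?_,
    ?_, ?_⟩ <;> simpa

theorem IsIdle.write {n d : ℕ} {s : Memory Reg} (hs : IsIdle n d s) (x : Bool) :
    IsIdle n d (s.write x) := by
  obtain ⟨⟨h1, h2, h3, h4, h5, h6, h7, h8, h9, h10, h11⟩, h12, h13, h14, h15⟩ := hs
  exact ⟨⟨h1, h2, h3, h4, h5, h6, h7, h8, h9, h10, h11⟩, h12, h13, h14, h15⟩

/-- Write the number of edges between `u` and `v`. -/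
def entryCmd : Cmd Reg :=
  seq (emit false) (seq (addTo w degree b) (countdown w codeCmd))

/-- The output is a stack, so an entry is written backwards with its final zero first; for the same
reason rows and columns are run through downwards. The invariant counts the codes w with k ≤ w < d.
-/
theorem run_entryCmd {n d i j : ℕ} {s : Memory Reg} (hs : IsIdle n d s) (hW : 4 * n + d + 32 ≤ W)
    (hu : s.reg u = i) (hv : s.reg v = j) (hw : s.reg w = 0) (hi : i < n) (hj : j < n) :
    IsIdle n d (entryCmd.run W s) ∧ (entryCmd.run W s).reg u = i ∧
      (entryCmd.run W s).reg v = j ∧ (entryCmd.run W s).reg w = 0 ∧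
      (entryCmd.run W s).out = List.replicate (walkCount n d i j) true ++ false :: s.out := by
  rw [entryCmd, run, run, run, run_addTo (by decide) (by decide) (by decide) (by simpa using hs.b)
    (by simp [hs.degree]; omega)]
  simp only [Memory.reg_write, hw, hs.degree, Nat.zero_add]
  refine countdown_rule (W := W) (A := d) (fun k s' => IsIdle n d s' ∧ s'.reg u = i ∧
    s'.reg v = j ∧ s'.reg w = k ∧
    s'.out = List.replicate ((Finset.Ico k d).filter (IsWalkCode n d i j)).card true
      ++ false :: s.out) (by omega) (fun k s' h => h.2.2.2.1) ?_ ?_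
  · rintro k hk s' ⟨h1, h2, h3, h4, h5⟩
    rw [run_codeCmd (h1.set (by simp) k) hW (by simp; omega) (by simp; omega) (by simp; omega)]
    simp only [Memory.reg_set, if_true, reduceCtorEq, if_false, h2, h3]
    rw [← Finset.insert_Ico_add_one_left_eq_Ico hk, Finset.filter_insert]
    split_ifs with h
    · refine ⟨(h1.set (by simp) k).write _, by simpa, by simpa, by simp, ?_⟩
      rw [Finset.card_insert_of_notMem (by simp), List.replicate_succ]
      simp [h5]
    · exact ⟨h1.set (by simp) k, by simpa, by simpa, by simp, by simp [h5]⟩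
  · exact ⟨(hs.write _).set (by simp) _, by simpa, by simpa, by simp, by simp⟩

/-- The list of the multiplicities of the edges from the vertex `i`. -/
def rowCode (n d i k : ℕ) : List Bool :=
  (List.range' k (n - k)).flatMap fun j => List.replicate (walkCount n d i j) true ++ [false]

/-- Write the multiplicities of all edges from `u`. -/
def rowCmd : Cmd Reg :=
  seq (addTo v size b) (countdown v entryCmd)

theorem run_rowCmd {n d i : ℕ} {s : Memory Reg} (hs : IsIdle n d s) (hW : 4 * n + d + 32 ≤ W)
    (hu : s.reg u = i) (hv : s.reg v = 0) (hw : s.reg w = 0) (hi : i < n) :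
    IsIdle n d (rowCmd.run W s) ∧ (rowCmd.run W s).reg u = i ∧
      (rowCmd.run W s).reg w = 0 ∧ (rowCmd.run W s).reg v = 0 ∧
      (rowCmd.run W s).out = rowCode n d i 0 ++ s.out := by
  rw [rowCmd, run, run_addTo (by decide) (by decide) (by decide) hs.b (by simp [hs.size]; omega)]
  simp only [hv, hs.size, Nat.zero_add]
  refine countdown_rule (W := W) (A := n) (fun k s' => IsIdle n d s' ∧ s'.reg u = i ∧
    s'.reg w = 0 ∧ s'.reg v = k ∧ s'.out = rowCode n d i k ++ s.out)
    (by omega) (fun k s' h => h.2.2.2.1) ?_ ?_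
  · rintro k hk s' ⟨h1, h2, h3, h4, h5⟩
    obtain ⟨e1, e2, e3, e4, e5⟩ := run_entryCmd (i := i) (j := k) (h1.set (i := v) (by simp) k) hW
      (by simpa) (by simp) (by simpa) hi hk
    refine ⟨e1, e2, e4, e3, ?_⟩
    rw [e5, Memory.out_set, h5, rowCode, rowCode, show n - k = n - (k + 1) + 1 by omega,
      List.range'_succ]
    simp
  · exact ⟨hs.set (by simp) _, by simpa, by simpa, by simp, by simp [rowCode]⟩

/-- Compute the side of the torus, its area, and the base of the digits. -/
def setupCmd : Cmd Reg :=
  seq (incBy base 16) (loop (seq (addTo c size b) (seq (subFrom c area b)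
    (ifz c skip (seq (clear c) (seq (addTo area side b) (seq (addTo area side b)
      (seq (inc area) (inc side)))))))))

/-- The side is found by linear search. The area is updated through (i + 1)² = i² + 2i + 1, and the
body idles as soon as the area is at least n. -/
theorem run_setupCmd {n d : ℕ} (hW : 4 * n + d + 32 ≤ W) :
    let s := setupCmd.run W ((⟨fun _ => 0, []⟩ : Memory Reg).set size n |>.set degree d)
    IsIdle n d s ∧ s.reg u = 0 ∧ s.reg v = 0 ∧ s.reg w = 0 ∧ s.out = [] := by
  intro s
  have hs : s = ((((⟨fun _ => 0, []⟩ : Memory Reg).set size n |>.set degree d).set base 16).set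
      side (torusSide n)).set area (torusSide n * torusSide n) := by
    have h1 := torusSide_le n
    have h2 := torusSide_mul_self_le n
    simp only [s]
    rw [setupCmd, run, run_incBy]
    refine run_loop_of (fun i => ((((⟨fun _ => 0, []⟩ : Memory Reg).set size n
      |>.set degree d).set base 16).set side i).set area (i * i)) (torusSide n) (by omega) ?_ ?_ ?_
    · ext i <;> cases i <;> simp
    · intro i hi
      have h3 := mul_self_lt_of_lt_torusSide hi
      rw [run, run_addTo (by decide) (by decide) (by decide) (by simp) (by simp; omega),
        run, run_subFrom (by decide) (by decide) (by decide) (by simp) (by simp; omega), run,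
        if_neg (by simp; omega), run, run_clear (by simp; omega),
        run, run_addTo (by decide) (by decide) (by decide) (by simp) (by simp; omega),
        run, run_addTo (by decide) (by decide) (by decide) (by simp) (by simp; omega)]
      ext j <;> cases j <;> simp [run]
      ring
    · have h3 := le_torusSide_mul_self n
      rw [run, run_addTo (by decide) (by decide) (by decide) (by simp) (by simp; omega),
        run, run_subFrom (by decide) (by decide) (by decide) (by simp) (by simp; omega), run,
        if_pos (by simp; omega), run]
      ext j <;> cases j <;> simp
      omega
  rw [hs]
  refine ⟨⟨⟨?_, ?_, ?_, ?_, ?_, ?_, ?_, ?_, ?_, ?_, ?_⟩, ?_, ?_, ?_, ?_⟩, ?_, ?_, ?_, ?_⟩ <;> simp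

/-- The list of the multiplicities of the edges from the vertices starting with `k`. -/
def tableCode (n d k : ℕ) : List Bool :=
  (List.range' k (n - k)).flatMap fun i => rowCode n d i 0

/-- The program that writes down the graphs. -/
def tableCmd : Cmd Reg :=
  seq setupCmd (seq (addTo u size b) (countdown u rowCmd))

theorem run_tableCmd {n d : ℕ} (hW : 4 * n + d + 32 ≤ W) :
    let s := tableCmd.run W ((⟨fun _ => 0, []⟩ : Memory Reg).set size n |>.set degree d)
    s.out = tableCode n d 0 ∧ ∀ i, s.reg i ≤ W := by
  intro s
  obtain ⟨h1, h2, h3, h4, h5⟩ := run_setupCmd hW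
  have hs : IsIdle n d s ∧ s.reg v = 0 ∧ s.reg w = 0 ∧ s.reg u = 0 ∧ s.out = tableCode n d 0 := by
    simp only [s]
    rw [tableCmd, run, run, run_addTo (by decide) (by decide) (by decide) h1.b
      (by simp only [h1.size]; omega), h2, h1.size, Nat.zero_add]
    refine countdown_rule (W := W) (A := n) (fun k s' => IsIdle n d s' ∧
      s'.reg v = 0 ∧ s'.reg w = 0 ∧ s'.reg u = k ∧ s'.out = tableCode n d k)
      (by omega) (fun k s' h => h.2.2.2.1) ?_ ?_
    · rintro k hk s' ⟨h1, h2, h3, h4, h5⟩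
      obtain ⟨e1, e2, e3, e4, e5⟩ := run_rowCmd (i := k) (h1.set (i := u) (by simp) k) hW
        (by simp) (by simpa) (by simpa) hk
      refine ⟨e1, e4, e3, e2, ?_⟩
      rw [e5, Memory.out_set, h5, tableCode, tableCode, show n - k = n - (k + 1) + 1 by omega,
        List.range'_succ]
      simp
    · exact ⟨h1.set (by simp) _, by simpa, by simpa, by simp, by simp [h5, tableCode]⟩
  obtain ⟨h, hv, hw, hu, ho⟩ := hs
  have h6 := torusSide_le n
  have h7 := torusSide_mul_self_le n
  refine ⟨ho, fun i => ?_⟩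
  cases i <;> simp [h.size, h.degree, h.side, h.area, h.base, hu, hv, hw, h.z, h.q, h.r, h.x,
    h.y, h.c, h.e, h.t, h.a, h.b] <;> omega

end Cmd

/-- The graphs whose edges are counted by `walkCount` can be written down in polynomial time. -/
theorem isExplicitFamily_of_mult (G : ∀ n _d : ℕ, BipartiteMultigraph (Fin n) (Fin n))
    (hG : ∀ n d u v, (G n d).mult u v = walkCount n d u v) : IsExplicitFamily G := by
  -- The program is correct for every loop length of at least 4n + d + 32, and the machine supplies
  -- C (n + d + 1), so C = 32 will do.
  have hW : ∀ n d : ℕ, 4 * n + d + 32 ≤ 32 * (n + d + 1) := fun n d => by omega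
  refine Cmd.nonempty_tm2ComputableInPolyTime Cmd.tableCmd .size .degree 32 (by decide) _ _
    (fun n d => ?_) (fun n d => (Cmd.run_tableCmd (hW n d)).2)
  rw [(Cmd.run_tableCmd (hW n d)).1]
  have key : ∀ f : ℕ → List Bool,
      (List.range' 0 n).flatMap f = (List.finRange n).flatMap fun i : Fin n => f i.val := by
    intro f
    rw [← List.range_eq_range', ← List.map_coe_finRange_eq_range, List.flatMap_map]
  simp only [Cmd.tableCode, Cmd.rowCode, encodeBipartite, Nat.sub_zero, key, hG]

/-! ### Fourier analysis and the spectral gap of the torus -/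

namespace TorusFourier

open Finset ZMod

variable {m : ℕ} [NeZero m]

/-- The Fourier transform of a function on the discrete torus. -/
noncomputable def transform (f : ZMod m × ZMod m → ℂ) (ξ : ZMod m × ZMod m) : ℂ :=
  ∑ p, f p * stdAddChar (ξ.1 * p.1 + ξ.2 * p.2)

theorem transform_sub (f g : ZMod m × ZMod m → ℂ) (ξ : ZMod m × ZMod m) :
    transform (fun p => f p - g p) ξ = transform f ξ - transform g ξ := by
  simp only [transform, sub_mul, sum_sub_distrib]

theorem sum_stdAddChar_mul (b : ZMod m) :
    ∑ a : ZMod m, (stdAddChar (a * b) : ℂ) = if b = 0 then (m : ℂ) else 0 := by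
  rw [AddChar.sum_mulShift b (isPrimitive_stdAddChar m)]
  split_ifs <;> simp [ZMod.card]

/-- Parseval's identity on the discrete torus. -/
theorem sum_norm_sq_transform (f : ZMod m × ZMod m → ℂ) :
    ∑ ξ, ‖transform f ξ‖ ^ 2 = (m : ℝ) ^ 2 * ∑ p, ‖f p‖ ^ 2 := by
  have h1 : ∀ ξ, ((‖transform f ξ‖ ^ 2 : ℝ) : ℂ) = ∑ p, ∑ q, (f p * (starRingEnd ℂ) (f q)) *
      (stdAddChar (ξ.1 * (p.1 - q.1)) * stdAddChar (ξ.2 * (p.2 - q.2))) := by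
    intro ξ
    push_cast
    rw [← Complex.mul_conj', transform, map_sum, sum_mul_sum]
    refine sum_congr rfl fun p _ => sum_congr rfl fun q _ => ?_
    have hχ : (stdAddChar (ξ.1 * (p.1 - q.1)) * stdAddChar (ξ.2 * (p.2 - q.2)) : ℂ)
        = stdAddChar (ξ.1 * p.1 + ξ.2 * p.2) * stdAddChar (-(ξ.1 * q.1 + ξ.2 * q.2)) := by
      rw [← AddChar.map_add_eq_mul, ← AddChar.map_add_eq_mul]
      congr 1
      ring
    rw [map_mul, ← AddChar.map_neg_eq_conj, hχ]
    ring
  have h2 : ∀ p q : ZMod m × ZMod m, ∑ ξ : ZMod m × ZMod m, (stdAddChar (ξ.1 * (p.1 - q.1)) *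
      stdAddChar (ξ.2 * (p.2 - q.2)) : ℂ) = if p = q then (m : ℂ) ^ 2 else 0 := by
    intro p q
    rw [Fintype.sum_prod_type]
    simp only []
    rw [← sum_mul_sum, sum_stdAddChar_mul, sum_stdAddChar_mul]
    simp only [sub_eq_zero]
    by_cases h : p = q
    · subst h; simp [sq]
    · rw [if_neg h]
      by_cases h' : p.1 = q.1
      · rw [if_neg fun h'' => h (Prod.ext h' h''), mul_zero]
      · rw [if_neg h', zero_mul]
  have h3 : ((∑ ξ, ‖transform f ξ‖ ^ 2 : ℝ) : ℂ) = (((m : ℝ) ^ 2 * ∑ p, ‖f p‖ ^ 2 : ℝ) : ℂ) := by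
    rw [Complex.ofReal_sum, sum_congr rfl fun ξ _ => h1 ξ, sum_comm]
    rw [sum_congr rfl fun p _ => sum_comm]
    simp only [← mul_sum, h2]
    simp only [mul_ite, mul_zero, sum_ite_eq, mem_univ, if_true]
    push_cast
    rw [mul_sum]
    refine sum_congr rfl fun p _ => ?_
    rw [Complex.mul_conj']
    ring
  exact_mod_cast h3

/-- The shear `(x, y) ↦ (x + y, y)`. -/
def shear : ZMod m × ZMod m ≃ ZMod m × ZMod m where
  toFun p := (p.1 + p.2, p.2)
  invFun p := (p.1 - p.2, p.2)
  left_inv p := by simp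
  right_inv p := by simp

/-- The shift `(x, y) ↦ (x + 1, y)`. -/
def shift : ZMod m × ZMod m ≃ ZMod m × ZMod m where
  toFun p := (p.1 + 1, p.2)
  invFun p := (p.1 - 1, p.2)
  left_inv p := by simp
  right_inv p := by simp

/-- On frequencies the shear becomes its inverse transpose, and the shift becomes multiplication by
a character. So the shear moves mass around, while the shift detects mass at frequencies whose first
coordinate is far from zero. -/
theorem transform_shear (f : ZMod m × ZMod m → ℂ) (ξ : ZMod m × ZMod m) :
    transform (fun p => f (shear p)) ξ = transform f (ξ.1, ξ.2 - ξ.1) := by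
  rw [transform, transform,
    ← shear.sum_comp (fun p => f p * stdAddChar (ξ.1 * p.1 + (ξ.2 - ξ.1) * p.2))]
  refine sum_congr rfl fun p _ => ?_
  congr 2
  simp only [shear, Equiv.coe_fn_mk]
  ring

theorem transform_shift (f : ZMod m × ZMod m → ℂ) (ξ : ZMod m × ZMod m) :
    transform (fun p => f (shift p)) ξ = stdAddChar (-ξ.1) * transform f ξ := by
  rw [transform, transform, ← shift.sum_comp (fun p => f p * stdAddChar (ξ.1 * p.1 + ξ.2 * p.2)),
    mul_sum]
  refine sum_congr rfl fun p _ => ?_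
  rw [mul_left_comm, ← AddChar.map_add_eq_mul]
  congr 2
  simp only [shift, Equiv.coe_fn_mk]
  ring

theorem transform_swap (f : ZMod m × ZMod m → ℂ) (ξ : ZMod m × ZMod m) :
    transform (fun p => f p.swap) ξ = transform f ξ.swap := by
  rw [transform, transform, ← (Equiv.prodComm _ _).sum_comp]
  refine sum_congr rfl fun p _ => ?_
  simp only [Equiv.prodComm_apply, Prod.swap_swap, Prod.fst_swap, Prod.snd_swap]
  rw [add_comm]

/-- The frequencies moved by at least a quarter turn by a shift. -/
def IsFar (a : ZMod m) : Prop :=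
  2 ≤ ‖(1 : ℂ) - stdAddChar (-a)‖ ^ 2

theorem norm_one_sub_sq (a : ZMod m) :
    ‖(1 : ℂ) - stdAddChar (-a)‖ ^ 2 = 2 - 2 * (stdAddChar a : ℂ).re := by
  have h1 : ‖(stdAddChar (-a) : ℂ)‖ = 1 := AddChar.norm_apply _ _
  have h2 : (stdAddChar (-a) : ℂ).re = (stdAddChar a : ℂ).re := by
    rw [AddChar.map_neg_eq_conj, Complex.conj_re]
  rw [← Complex.normSq_eq_norm_sq] at *
  have h3 : Complex.normSq (stdAddChar (-a) : ℂ) = 1 := by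
    rw [Complex.normSq_eq_norm_sq, h1, one_pow]
  rw [Complex.normSq_sub, h3]
  simp [h2]
  ring

theorem isFar_iff (a : ZMod m) : IsFar a ↔ (stdAddChar a : ℂ).re ≤ 0 := by
  rw [IsFar, norm_one_sub_sq]
  constructor <;> intro h <;> linarith

theorem isFar_neg (a : ZMod m) : IsFar (-a) ↔ IsFar a := by
  rw [isFar_iff, isFar_iff, AddChar.map_neg_eq_conj, Complex.conj_re]

/-- The hypotheses place the angle 2πk/m between π/2 and 3π/2, where the cosine is not positive. -/
theorem isFar_natCast {k : ℕ} (h1 : m ≤ 4 * k) (h2 : 4 * k ≤ 3 * m) : IsFar (k : ZMod m) := by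
  rw [isFar_iff, stdAddChar_apply, toCircle_natCast]
  have hm : (0 : ℝ) < m := by exact_mod_cast NeZero.pos m
  have h3 : (2 * Real.pi * Complex.I * k / m : ℂ)
      = ((2 * Real.pi * k / m : ℝ) : ℂ) * Complex.I := by
    push_cast; ring
  rw [h3, Complex.exp_ofReal_mul_I_re]
  have hpi := Real.pi_pos
  have h1' : (m : ℝ) ≤ 4 * k := by exact_mod_cast h1
  have h2' : (4 : ℝ) * k ≤ 3 * m := by exact_mod_cast h2
  apply Real.cos_nonpos_of_pi_div_two_le_of_le
  · rw [le_div_iff₀ hm]; nlinarith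
  · rw [div_le_iff₀ hm]; nlinarith

/-- Frequencies are far or represented by an integer of size at most `m / 4`. -/
theorem isFar_or (a : ZMod m) : IsFar a ∨ ∃ i ≤ m / 4, a = i ∨ a = -(i : ZMod m) := by
  have ha : ((a.val : ℕ) : ZMod m) = a := natCast_zmod_val a
  have hlt := a.val_lt
  by_cases h1 : a.val ≤ m / 4
  · exact .inr ⟨a.val, h1, .inl ha.symm⟩
  by_cases h2 : m - a.val ≤ m / 4
  · refine .inr ⟨m - a.val, h2, .inr ?_⟩
    rw [Nat.cast_sub hlt.le, ha]; simp
  · left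
    rw [← ha]
    exact isFar_natCast (by omega) (by omega)

end TorusFourier

namespace TorusFourier

open Finset ZMod

/-- Factor the difference of squares and apply the inequality of arithmetic and geometric means with
weight c. The weight is chosen later, so that the second term can be absorbed. -/
theorem sq_sub_sq_le_of_norm_sub (x y : ℂ) {c : ℝ} (hc : 0 < c) :
    ‖x‖ ^ 2 - ‖y‖ ^ 2 ≤ c * ‖x - y‖ ^ 2 + (‖x‖ ^ 2 + ‖y‖ ^ 2) / (2 * c) := by
  have h1 : ‖x‖ - ‖y‖ ≤ ‖x - y‖ := norm_sub_norm_le x y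
  have h2 : 0 ≤ ‖x‖ + ‖y‖ := by positivity
  have h3 : ‖x‖ ^ 2 - ‖y‖ ^ 2 ≤ ‖x - y‖ * (‖x‖ + ‖y‖) := by nlinarith
  have h4 : ‖x - y‖ * (‖x‖ + ‖y‖) ≤ c * ‖x - y‖ ^ 2 + (‖x‖ + ‖y‖) ^ 2 / (4 * c) := by
    have h : c * ‖x - y‖ ^ 2 + (‖x‖ + ‖y‖) ^ 2 / (4 * c) - ‖x - y‖ * (‖x‖ + ‖y‖)
        = (2 * c * ‖x - y‖ - (‖x‖ + ‖y‖)) ^ 2 / (4 * c) := by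
      field_simp; ring
    have : 0 ≤ (2 * c * ‖x - y‖ - (‖x‖ + ‖y‖)) ^ 2 / (4 * c) := by positivity
    linarith
  have h5 : (‖x‖ + ‖y‖) ^ 2 / (4 * c) ≤ (‖x‖ ^ 2 + ‖y‖ ^ 2) / (2 * c) := by
    rw [div_le_div_iff₀ (by positivity) (by positivity)]
    nlinarith [sq_nonneg (‖x‖ - ‖y‖)]
  linarith

/-- If a function is almost invariant under a permutation, then so are its square sums. -/
theorem sum_norm_sq_le_of_invariant {ι α : Type*} [Fintype α] (F : α → ℂ) (A : α ≃ α)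
    {c E : ℝ} (hc : 0 < c) (hA : ∑ ξ, ‖F ξ - F (A ξ)‖ ^ 2 ≤ E) (X : Finset ι) (g : ι → α)
    (hg : Set.InjOn g X) :
    ∑ i ∈ X, ‖F (g i)‖ ^ 2
      ≤ ∑ i ∈ X, ‖F (A (g i))‖ ^ 2 + (c * E + (∑ ξ, ‖F ξ‖ ^ 2) / c) := by
  classical
  set Q : α → ℝ := fun ξ =>
    c * ‖F ξ - F (A ξ)‖ ^ 2 + (‖F ξ‖ ^ 2 + ‖F (A ξ)‖ ^ 2) / (2 * c) with hQ
  have h0 : ∀ ξ, 0 ≤ Q ξ := fun ξ => by simp only [hQ]; positivity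
  have h1 : ∑ i ∈ X, (‖F (g i)‖ ^ 2 - ‖F (A (g i))‖ ^ 2) ≤ ∑ i ∈ X, Q (g i) :=
    sum_le_sum fun i _ => sq_sub_sq_le_of_norm_sub _ _ hc
  have h2 : ∑ i ∈ X, Q (g i) ≤ ∑ ξ, Q ξ := by
    rw [← sum_image hg]
    exact sum_le_sum_of_subset_of_nonneg (subset_univ _) fun ξ _ _ => h0 ξ
  have h3 : ∑ ξ, Q ξ = c * ∑ ξ, ‖F ξ - F (A ξ)‖ ^ 2 + (∑ ξ, ‖F ξ‖ ^ 2) / c := by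
    simp only [hQ, sum_add_distrib, ← mul_sum, ← sum_div]
    rw [A.sum_comp fun ξ => ‖F ξ‖ ^ 2]
    field_simp
    ring
  rw [sum_sub_distrib] at h1
  have := mul_le_mul_of_nonneg_left hA hc.le
  linarith

variable {m : ℕ} [NeZero m]

/-- The signs `1` and `-1`. -/
def sign (m : ℕ) : Bool → ZMod m
  | true => 1
  | false => -1

omit [NeZero m] in
theorem sign_mul_self (s : Bool) : sign m s * sign m s = 1 := by
  cases s <;> simp [sign]

/-- A quadrant of the torus of frequencies. -/
def quadrant (s t : Bool) (i : ℕ × ℕ) : ZMod m × ZMod m :=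
  (sign m s * i.1, sign m t * i.2)

omit [NeZero m] in
theorem quadrant_injOn (s t : Bool) {X : Set (ℕ × ℕ)} (hX : ∀ i ∈ X, i.1 < m ∧ i.2 < m) :
    Set.InjOn (quadrant (m := m) s t) X := by
  have key : ∀ (s : Bool) {a b : ℕ}, a < m → b < m → sign m s * a = sign m s * b → a = b := by
    intro s a b ha hb h
    have h' : (a : ZMod m) = b := by
      have := congrArg (sign m s * ·) h
      simpa only [← mul_assoc, sign_mul_self, one_mul] using this
    have := congrArg ZMod.val h'
    rwa [ZMod.val_natCast_of_lt ha, ZMod.val_natCast_of_lt hb] at this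
  intro i hi j hj h
  simp only [quadrant, Prod.mk.injEq] at h
  exact Prod.ext (key s (hX i hi).1 (hX j hj).1 h.1) (key t (hX i hi).2 (hX j hj).2 h.2)

theorem isFar_sign_mul (s : Bool) (a : ZMod m) : IsFar (sign m s * a) ↔ IsFar a := by
  cases s
  · rw [sign, neg_one_mul, isFar_neg]
  · rw [sign, one_mul]

/-- The shear of frequencies, `(a, b) ↦ (a, b + u a)`. -/
def dualShear (u : ZMod m) : ZMod m × ZMod m ≃ ZMod m × ZMod m where
  toFun ξ := (ξ.1, ξ.2 + u * ξ.1)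
  invFun ξ := (ξ.1, ξ.2 - u * ξ.1)
  left_inv ξ := by simp
  right_inv ξ := by simp

/-- The sign is chosen so that the shear maps the quadrant to itself with growing coordinates. The
shear by -1 is the one in the hypothesis; the shear by 1 is its inverse, handled by substitution. -/
theorem sum_dualShear_le {F : ZMod m × ZMod m → ℂ} {E : ℝ}
    (h : ∑ ξ : ZMod m × ZMod m, ‖F ξ - F (ξ.1, ξ.2 - ξ.1)‖ ^ 2 ≤ E) (s t : Bool) :
    ∑ ξ, ‖F ξ - F (dualShear (sign m s * sign m t) ξ)‖ ^ 2 ≤ E := by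
  have h1 : ∑ ξ, ‖F ξ - F (dualShear 1 ξ)‖ ^ 2 ≤ E := by
    rw [← (dualShear (m := m) 1).sum_comp] at h
    refine le_trans (le_of_eq (sum_congr rfl fun ξ _ => ?_)) h
    rw [norm_sub_rev]
    simp [dualShear]
  have h2 : ∑ ξ, ‖F ξ - F (dualShear (-1) ξ)‖ ^ 2 ≤ E := by
    refine le_trans (le_of_eq (sum_congr rfl fun ξ _ => ?_)) h
    simp [dualShear, sub_eq_add_neg]
  cases s <;> cases t <;> simpa [sign]

/-- The box of points of a quadrant that are close to the origin. -/
def box (K : ℕ) : Finset (ℕ × ℕ) :=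
  Icc 1 K ×ˢ range (K + 1)

theorem mem_box {K : ℕ} {i : ℕ × ℕ} : i ∈ box K ↔ (1 ≤ i.1 ∧ i.1 ≤ K) ∧ i.2 ≤ K := by
  simp [box]

theorem box_subset (K : ℕ) : box K ⊆ box (2 * K) := fun i hi => by
  rw [mem_box] at *; omega

/-- Two disjoint copies of a box fit into the box of twice the size. -/
theorem sum_box_add_sum_box_le (f : ℕ × ℕ → ℝ) (hf : ∀ i, 0 ≤ f i) (K : ℕ) :
    ∑ i ∈ box K, f (i.1, i.1 + i.2) + ∑ i ∈ box K, f (i.1 + i.2, i.2)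
      ≤ ∑ i ∈ box (2 * K), f i := by
  have h1 : Set.InjOn (fun i : ℕ × ℕ => (i.1, i.1 + i.2)) (box K) := by
    rintro ⟨a, b⟩ _ ⟨a', b'⟩ _ h
    simp only [Prod.mk.injEq] at h ⊢
    omega
  have h2 : Set.InjOn (fun i : ℕ × ℕ => (i.1 + i.2, i.2)) (box K) := by
    rintro ⟨a, b⟩ _ ⟨a', b'⟩ _ h
    simp only [Prod.mk.injEq] at h ⊢
    omega
  rw [← sum_image (f := f) h1, ← sum_image (f := f) h2, ← sum_union]
  · refine sum_le_sum_of_subset_of_nonneg ?_ fun i _ _ => hf i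
    intro i hi
    rw [mem_union, mem_image, mem_image] at hi
    rw [mem_box]
    rcases hi with ⟨j, hj, rfl⟩ | ⟨j, hj, rfl⟩ <;> rw [mem_box] at hj <;> simp only <;> omega
  -- In the first image the second coordinate is at least the first; in the second image it is
  -- smaller, because points of the box have positive first coordinate.
  · rw [disjoint_left]
    intro i hi hi'
    rw [mem_image] at hi hi'
    obtain ⟨j, hj, rfl⟩ := hi
    obtain ⟨k, hk, h⟩ := hi'
    rw [mem_box] at hj hk
    simp only [Prod.mk.injEq] at h
    omega

section

variable {F : ZMod m × ZMod m → ℂ} {E : ℝ}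
  (h1 : ∑ ξ : ZMod m × ZMod m, ‖F ξ - F (ξ.1, ξ.2 - ξ.1)‖ ^ 2 ≤ E)
  (h2 : ∑ ξ : ZMod m × ZMod m, ‖(1 : ℂ) - stdAddChar (-ξ.1)‖ ^ 2 * ‖F ξ‖ ^ 2 ≤ E)
  (h3 : ∑ ξ : ZMod m × ZMod m, ‖F ξ - F ξ.swap‖ ^ 2 ≤ E)

-- At a far first coordinate the shift energy has weight at least 2, so that mass is at most E / 2.
-- The swap carries the bound over to the second coordinate at the price of one invariance error.
include h2 h3 in
open Classical in
theorem sum_far_le {c : ℝ} (hc : 0 < c) :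
    ∑ ξ with IsFar ξ.1 ∨ IsFar ξ.2, ‖F ξ‖ ^ 2 ≤ E + (c * E + (∑ ξ, ‖F ξ‖ ^ 2) / c) := by
  have hfst : ∑ ξ : ZMod m × ZMod m with IsFar ξ.1, ‖F ξ‖ ^ 2 ≤ E / 2 := by
    have : ∑ ξ : ZMod m × ZMod m with IsFar ξ.1, 2 * ‖F ξ‖ ^ 2 ≤ E := by
      refine le_trans ?_ h2
      refine (sum_le_sum fun ξ hξ => ?_).trans
        (sum_le_sum_of_subset_of_nonneg (filter_subset _ _) fun ξ _ _ => by positivity)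
      exact mul_le_mul_of_nonneg_right (mem_filter.1 hξ).2 (by positivity)
    rw [← mul_sum] at this
    linarith
  have hsnd := sum_norm_sq_le_of_invariant F (Equiv.prodComm _ _) hc h3
    (univ.filter fun ξ : ZMod m × ZMod m => IsFar ξ.2) id Function.injective_id.injOn
  have hswap : ∑ ξ : ZMod m × ZMod m with IsFar ξ.2, ‖F (Equiv.prodComm _ _ (id ξ))‖ ^ 2
      = ∑ ξ : ZMod m × ZMod m with IsFar ξ.1, ‖F ξ‖ ^ 2 := by
    rw [sum_filter, sum_filter, ← (Equiv.prodComm (ZMod m) (ZMod m)).sum_comp]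
    rfl
  rw [hswap] at hsnd
  rw [filter_or]
  have hun := sum_union_inter (s₁ := univ.filter fun ξ : ZMod m × ZMod m => IsFar ξ.1)
    (s₂ := univ.filter fun ξ : ZMod m × ZMod m => IsFar ξ.2) (f := fun ξ => ‖F ξ‖ ^ 2)
  have hin : 0 ≤ ∑ ξ ∈ (univ.filter fun ξ : ZMod m × ZMod m => IsFar ξ.1) ∩
      (univ.filter fun ξ : ZMod m × ZMod m => IsFar ξ.2), ‖F ξ‖ ^ 2 :=
    sum_nonneg fun ξ _ => by positivity
  simp only [id] at hsnd
  linarith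

-- Let N be the mass of the box and δ the error of one use of invariance. The shear gives one copy
-- of the box with error δ, and swap, shear, swap gives a disjoint copy with error 3δ. Both lie in
-- the doubled box, whose points outside the box are far, so 2N ≤ N + (far mass) + 4δ.
include h1 h3 in
open Classical in
theorem sum_quadrant_le {c : ℝ} (hc : 0 < c) (s t : Bool) :
    ∑ i ∈ box (m / 4), ‖F (quadrant s t i)‖ ^ 2
      ≤ ∑ ξ with IsFar ξ.1 ∨ IsFar ξ.2, ‖F ξ‖ ^ 2
        + 4 * (c * E + (∑ ξ, ‖F ξ‖ ^ 2) / c) := by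
  set K := m / 4 with hK
  have hm := NeZero.pos m
  have hinj : Set.InjOn (quadrant (m := m) s t) (box K) :=
    quadrant_injOn s t fun i hi => by rw [mem_coe, mem_box] at hi; omega
  have hinj2 : Set.InjOn (quadrant (m := m) s t) (box (2 * K)) :=
    quadrant_injOn s t fun i hi => by rw [mem_coe, mem_box] at hi; omega
  have e1 := sum_norm_sq_le_of_invariant F (dualShear (sign m s * sign m t)) hc
    (sum_dualShear_le h1 s t) (box K) (quadrant s t) hinj
  have e2 := sum_norm_sq_le_of_invariant F (Equiv.prodComm _ _) hc h3 (box K) (quadrant s t) hinj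
  have e3 := sum_norm_sq_le_of_invariant F (dualShear (sign m s * sign m t)) hc
    (sum_dualShear_le h1 s t) (box K) (fun i => Equiv.prodComm _ _ (quadrant s t i))
    fun i hi j hj h => hinj hi hj ((Equiv.prodComm _ _).injective h)
  have e4 := sum_norm_sq_le_of_invariant F (Equiv.prodComm _ _) hc h3 (box K)
    (fun i => dualShear (sign m s * sign m t) (Equiv.prodComm _ _ (quadrant s t i)))
    fun i hi j hj h => hinj hi hj ((Equiv.prodComm _ _).injective ((Equiv.injective _) h))
  have q1 : ∀ i, dualShear (sign m s * sign m t) (quadrant s t i)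
      = quadrant s t (i.1, i.1 + i.2) := by
    intro i
    simp only [dualShear, Equiv.coe_fn_mk, quadrant, Prod.mk.injEq, true_and]
    push_cast
    linear_combination (sign m t * i.1) * sign_mul_self (m := m) s
  have q2 : ∀ i, Equiv.prodComm _ _ (dualShear (sign m s * sign m t)
      (Equiv.prodComm _ _ (quadrant s t i))) = quadrant s t (i.1 + i.2, i.2) := by
    intro i
    simp only [dualShear, Equiv.coe_fn_mk, quadrant, Equiv.prodComm_apply, Prod.swap_prod_mk,
      Prod.mk.injEq, and_true]
    push_cast
    linear_combination (sign m s * i.2) * sign_mul_self (m := m) t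
  simp only [q1] at e1
  simp only [q2] at e4
  have e5 := sum_box_add_sum_box_le (fun i => ‖F (quadrant s t i)‖ ^ 2)
    (fun i => by positivity) K
  have e6 : ∑ i ∈ box (2 * K), ‖F (quadrant s t i)‖ ^ 2
      ≤ ∑ i ∈ box K, ‖F (quadrant s t i)‖ ^ 2
        + ∑ ξ with IsFar ξ.1 ∨ IsFar ξ.2, ‖F ξ‖ ^ 2 := by
    rw [← sum_sdiff (box_subset K), add_comm]
    gcongr
    rw [← sum_image (f := fun ξ => ‖F ξ‖ ^ 2)
      (hinj2.mono (by exact_mod_cast sdiff_subset))]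
    refine sum_le_sum_of_subset_of_nonneg ?_ fun ξ _ _ => by positivity
    intro ξ hξ
    obtain ⟨i, hi, rfl⟩ := mem_image.1 hξ
    rw [mem_sdiff, mem_box, mem_box] at hi
    rw [mem_filter]
    refine ⟨mem_univ _, ?_⟩
    simp only [quadrant, isFar_sign_mul]
    by_cases h : K < i.1
    · exact .inl (isFar_natCast (by omega) (by omega))
    · exact .inr (isFar_natCast (by omega) (by omega))
  linarith

include h1 h2 h3 in
/-- A function of the frequencies that vanishes at the origin is not almost invariant. -/
theorem sum_norm_sq_le_energy (h0 : F 0 = 0) : ∑ ξ, ‖F ξ‖ ^ 2 ≤ 4370 * E := by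
  classical
  set K := m / 4 with hK
  have hm := NeZero.pos m
  set T := ∑ ξ, ‖F ξ‖ ^ 2 with hT
  set f := ∑ ξ with IsFar ξ.1 ∨ IsFar ξ.2, ‖F ξ‖ ^ 2 with hf
  -- Put δ = 66 E + T / 66. The far set, four quadrants and two half axes give T ≤ f + 4 (f + 4δ) +
  -- 2 (f + 5δ) = 7f + 26δ ≤ 7E + 33δ. As 66 = 2 · 33, the share of T on the right is T / 2, whence
  -- T ≤ 2 (7 + 33 · 66) E = 4370 E.
  have hfar : f ≤ E + (66 * E + T / 66) := sum_far_le h2 h3 (by norm_num)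
  have hN : ∀ s t, ∑ i ∈ box K, ‖F (quadrant s t i)‖ ^ 2 ≤ f + 4 * (66 * E + T / 66) :=
    fun s t => sum_quadrant_le h1 h3 (by norm_num) s t
  -- The boxes contain the half axes with second coordinate zero but not those with first coordinate
  -- zero; one swap takes the latter to the former.
  have hax : ∀ s, ∑ i ∈ Icc 1 K, ‖F (quadrant true s (0, i))‖ ^ 2
      ≤ f + 5 * (66 * E + T / 66) := by
    intro s
    have e1 := sum_norm_sq_le_of_invariant F (Equiv.prodComm _ _) (c := 66) (by norm_num) h3
      (Icc 1 K) (fun i => quadrant true s (0, i)) fun i hi j hj h => by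
        rw [coe_Icc, Set.mem_Icc] at hi hj
        have := quadrant_injOn (m := m) true s (X := {(0, i), (0, j)})
          (by rintro k (rfl | rfl) <;> simp only <;> omega) (by simp) (by simp) h
        simpa using this
    have e2 : ∑ i ∈ Icc 1 K, ‖F (Equiv.prodComm _ _ (quadrant true s (0, i)))‖ ^ 2
        ≤ ∑ i ∈ box K, ‖F (quadrant s true i)‖ ^ 2 := by
      have h : ∀ i : ℕ, Equiv.prodComm _ _ (quadrant (m := m) true s (0, i))
          = quadrant s true (i, 0) := by
        intro i; simp [quadrant, Prod.swap]
      simp only [h]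
      rw [box, sum_product]
      refine sum_le_sum fun i _ => ?_
      exact single_le_sum (f := fun j => ‖F (quadrant s true (i, j))‖ ^ 2)
        (fun j _ => by positivity) (by simp)
    linarith [hN s true]
  have hcover : ∀ ξ, ‖F ξ‖ ^ 2 ≤ (if IsFar ξ.1 ∨ IsFar ξ.2 then ‖F ξ‖ ^ 2 else 0)
      + ∑ s, ∑ t, ∑ i ∈ box K, (if quadrant s t i = ξ then ‖F ξ‖ ^ 2 else 0)
      + ∑ s, ∑ i ∈ Icc 1 K, (if quadrant true s (0, i) = ξ then ‖F ξ‖ ^ 2 else 0) := by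
    intro ξ
    have p1 : 0 ≤ if IsFar ξ.1 ∨ IsFar ξ.2 then ‖F ξ‖ ^ 2 else 0 := by positivity
    have p2 : 0 ≤ ∑ s, ∑ t, ∑ i ∈ box K, (if quadrant s t i = ξ then ‖F ξ‖ ^ 2 else 0) := by
      positivity
    have p3 : 0 ≤ ∑ s, ∑ i ∈ Icc 1 K,
        (if quadrant true s (0, i) = ξ then ‖F ξ‖ ^ 2 else 0) := by positivity
    by_cases hξ : IsFar ξ.1 ∨ IsFar ξ.2
    · rw [if_pos hξ]; linarith
    rw [not_or] at hξ
    have hsign : ∀ {a : ZMod m} {i : ℕ}, a = i ∨ a = -(i : ZMod m) → ∃ s, sign m s * i = a := by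
      rintro a i (h | h)
      · exact ⟨true, by simp [sign, h]⟩
      · exact ⟨false, by simp [sign, h]⟩
    obtain ⟨i, hi, hai⟩ := (isFar_or ξ.1).resolve_left hξ.1
    obtain ⟨j, hj, haj⟩ := (isFar_or ξ.2).resolve_left hξ.2
    obtain ⟨s, hs⟩ := hsign hai
    obtain ⟨t, ht⟩ := hsign haj
    have hq : quadrant s t (i, j) = ξ := Prod.ext hs ht
    rcases Nat.eq_zero_or_pos i with rfl | hi0
    · rcases Nat.eq_zero_or_pos j with rfl | hj0
      · have : ξ = 0 := by rw [← hq]; simp [quadrant]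
        rw [this, h0]
        simp only [this, h0, norm_zero] at p1 p2 p3
        simp only [norm_zero]
        have : (0 : ℝ) ^ 2 = 0 := by norm_num
        linarith
      · have hq' : quadrant true t (0, j) = ξ := by rw [← hq]; simp [quadrant]
        have : ‖F ξ‖ ^ 2 ≤ ∑ s, ∑ i ∈ Icc 1 K,
            (if quadrant true s (0, i) = ξ then ‖F ξ‖ ^ 2 else 0) := by
          refine le_trans ?_ (single_le_sum (f := fun s => ∑ i ∈ Icc 1 K,
            (if quadrant true s (0, i) = ξ then ‖F ξ‖ ^ 2 else 0))
            (fun s _ => by positivity) (mem_univ t))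
          refine le_trans ?_ (single_le_sum (f := fun i =>
            (if quadrant true t (0, i) = ξ then ‖F ξ‖ ^ 2 else 0))
            (fun s _ => by positivity) (mem_Icc.2 ⟨hj0, hj⟩))
          simp only [if_pos hq', le_refl]
        linarith
    · have : ‖F ξ‖ ^ 2 ≤ ∑ s, ∑ t, ∑ i ∈ box K,
          (if quadrant s t i = ξ then ‖F ξ‖ ^ 2 else 0) := by
        refine le_trans ?_ (single_le_sum (f := fun s => ∑ t, ∑ i ∈ box K,
          (if quadrant s t i = ξ then ‖F ξ‖ ^ 2 else 0))
          (fun s _ => by positivity) (mem_univ s))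
        refine le_trans ?_ (single_le_sum (f := fun t => ∑ i ∈ box K,
          (if quadrant s t i = ξ then ‖F ξ‖ ^ 2 else 0))
          (fun s _ => by positivity) (mem_univ t))
        refine le_trans ?_ (single_le_sum (f := fun i =>
          (if quadrant s t i = ξ then ‖F ξ‖ ^ 2 else 0))
          (fun s _ => by positivity) (show (i, j) ∈ box K from mem_box.2 ⟨⟨hi0, hi⟩, hj⟩))
        simp only [if_pos hq, le_refl]
      linarith
  have hsum := sum_le_sum fun ξ (_ : ξ ∈ univ) => hcover ξ
  rw [sum_add_distrib, sum_add_distrib, ← sum_filter] at hsum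
  have r1 : ∑ ξ, ∑ s, ∑ t, ∑ i ∈ box K,
      (if quadrant s t i = ξ then ‖F ξ‖ ^ 2 else 0)
      = ∑ s, ∑ t, ∑ i ∈ box K, ‖F (quadrant s t i)‖ ^ 2 := by
    rw [sum_comm]
    refine sum_congr rfl fun s _ => ?_
    rw [sum_comm]
    refine sum_congr rfl fun t _ => ?_
    rw [sum_comm]
    simp
  have r2 : ∑ ξ, ∑ s, ∑ i ∈ Icc 1 K,
      (if quadrant true s (0, i) = ξ then ‖F ξ‖ ^ 2 else 0)
      = ∑ s, ∑ i ∈ Icc 1 K, ‖F (quadrant true s (0, i))‖ ^ 2 := by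
    rw [sum_comm]
    refine sum_congr rfl fun s _ => ?_
    rw [sum_comm]
    simp
  rw [r1, r2] at hsum
  simp only [Fintype.sum_bool] at hsum
  have := hN true true
  have := hN true false
  have := hN false true
  have := hN false false
  have := hax true
  have := hax false
  linarith

end

/-- The spectral gap of the discrete torus with a shear, a shift and a swap. -/
theorem sum_sq_le_energy (f : ZMod m × ZMod m → ℝ) (hf : ∑ p, f p = 0) :
    ∑ p, f p ^ 2 ≤ 4370 * ∑ p, ((f p - f (shear p)) ^ 2 + (f p - f (shift p)) ^ 2
      + (f p - f p.swap) ^ 2) := by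
  have hm : (0 : ℝ) < (m : ℝ) ^ 2 := by
    have : (0 : ℝ) < m := by exact_mod_cast NeZero.pos m
    positivity
  set g : ZMod m × ZMod m → ℂ := fun p => (f p : ℂ) with hg
  have hnorm : ∀ x : ℝ, ‖(x : ℂ)‖ ^ 2 = x ^ 2 := fun x => by simp
  have p0 : ∑ ξ, ‖transform g ξ‖ ^ 2 = (m : ℝ) ^ 2 * ∑ p, f p ^ 2 := by
    rw [sum_norm_sq_transform]; simp only [hg, hnorm]
  have p1 : ∑ ξ : ZMod m × ZMod m, ‖transform g ξ - transform g (ξ.1, ξ.2 - ξ.1)‖ ^ 2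
      = (m : ℝ) ^ 2 * ∑ p, (f p - f (shear p)) ^ 2 := by
    simp only [← transform_shear, ← transform_sub]
    rw [sum_norm_sq_transform]
    simp only [hg, ← Complex.ofReal_sub, hnorm]
  have p2 : ∑ ξ : ZMod m × ZMod m, ‖(1 : ℂ) - stdAddChar (-ξ.1)‖ ^ 2 * ‖transform g ξ‖ ^ 2
      = (m : ℝ) ^ 2 * ∑ p, (f p - f (shift p)) ^ 2 := by
    simp only [← mul_pow, ← norm_mul, sub_mul, one_mul, ← transform_shift, ← transform_sub]
    rw [sum_norm_sq_transform]
    simp only [hg, ← Complex.ofReal_sub, hnorm]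
  have p3 : ∑ ξ : ZMod m × ZMod m, ‖transform g ξ - transform g ξ.swap‖ ^ 2
      = (m : ℝ) ^ 2 * ∑ p, (f p - f p.swap) ^ 2 := by
    simp only [← transform_swap, ← transform_sub]
    rw [sum_norm_sq_transform]
    simp only [hg, ← Complex.ofReal_sub, hnorm]
  have n1 : 0 ≤ ∑ p, (f p - f (shear p)) ^ 2 := by positivity
  have n2 : 0 ≤ ∑ p, (f p - f (shift p)) ^ 2 := by positivity
  have n3 : 0 ≤ ∑ p, (f p - f p.swap) ^ 2 := by positivity
  have h0 : transform g 0 = 0 := by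
    simp only [transform, Prod.fst_zero, Prod.snd_zero, zero_mul, add_zero, AddChar.map_zero_eq_one,
      mul_one, hg]
    exact_mod_cast hf
  -- By Parseval each of the three energies is m² times its counterpart on the torus, so their sum
  -- is a common bound E.
  have key := sum_norm_sq_le_energy (F := transform g) (E := (m : ℝ) ^ 2 * ∑ p,
    ((f p - f (shear p)) ^ 2 + (f p - f (shift p)) ^ 2 + (f p - f p.swap) ^ 2)) ?_ ?_ ?_ h0
  · rw [p0] at key
    have : (m : ℝ) ^ 2 * ∑ p, f p ^ 2 ≤ (m : ℝ) ^ 2 * (4370 * ∑ p,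
      ((f p - f (shear p)) ^ 2 + (f p - f (shift p)) ^ 2 + (f p - f p.swap) ^ 2)) := by linarith
    exact le_of_mul_le_mul_left this hm
  · rw [p1, sum_add_distrib, sum_add_distrib]
    exact mul_le_mul_of_nonneg_left (by linarith) hm.le
  · rw [p2, sum_add_distrib, sum_add_distrib]
    exact mul_le_mul_of_nonneg_left (by linarith) hm.le
  · rw [p3, sum_add_distrib, sum_add_distrib]
    exact mul_le_mul_of_nonneg_left (by linarith) hm.le

end TorusFourier

/-! ### Transfer of the spectral gap to n vertices -/

open TorusFourier Finset in
/-- The vertex represented by a point of the torus. -/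
def torusVertex (n : ℕ) (p : ZMod (torusSide n) × ZMod (torusSide n)) : ℕ :=
  foldIndex n (p.1.val * torusSide n + p.2.val)

section

open TorusFourier Finset

theorem sum_range_mul_self {m : ℕ} [NeZero m] (h : ℕ → ℝ) :
    ∑ i ∈ range (m * m), h i = ∑ p : ZMod m × ZMod m, h (p.1.val * m + p.2.val) := by
  have hm := NeZero.pos m
  refine sum_nbij' (fun i => (((i / m : ℕ) : ZMod m), ((i % m : ℕ) : ZMod m)))
    (fun p => p.1.val * m + p.2.val) (fun i _ => mem_univ _) ?_ ?_ ?_ ?_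
  · intro p _
    exact mem_range.2 (Cmd.mul_add_lt p.1.val_lt p.2.val_lt)
  · intro i hi
    simp only
    rw [ZMod.val_natCast_of_lt (Nat.div_lt_of_lt_mul (mem_range.1 hi)),
      ZMod.val_natCast_of_lt (Nat.mod_lt _ hm), mul_comm, Nat.div_add_mod]
  · intro p _
    have h1 := p.2.val_lt
    rw [add_comm, Nat.add_mul_div_right _ _ hm, Nat.add_mul_mod_self_right,
      Nat.div_eq_of_lt h1, Nat.mod_eq_of_lt h1]
    simp
  · intro i hi
    simp only
    rw [ZMod.val_natCast_of_lt (Nat.div_lt_of_lt_mul (mem_range.1 hi)),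
      ZMod.val_natCast_of_lt (Nat.mod_lt _ hm), mul_comm, Nat.div_add_mod]

theorem sum_torusMove {n : ℕ} [NeZero (torusSide n)] (φ : ℕ → ℕ → ℝ)
    (p : ZMod (torusSide n) × ZMod (torusSide n)) :
    ∑ g ∈ range 8, φ (torusVertex n p)
      (foldIndex n ((torusMove (torusSide n) g p.1.val p.2.val).1 * torusSide n
        + (torusMove (torusSide n) g p.1.val p.2.val).2))
    = φ (torusVertex n p) (torusVertex n (shear p))
      + φ (torusVertex n p) (torusVertex n (shear.symm p))
      + φ (torusVertex n p) (torusVertex n (shift p))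
      + φ (torusVertex n p) (torusVertex n (shift.symm p))
      + φ (torusVertex n p) (torusVertex n p.swap)
      + 3 * φ (torusVertex n p) (torusVertex n p) := by
  have hm := NeZero.pos (torusSide n)
  have hval : ∀ (k : ℕ) (z : ZMod (torusSide n)), (k : ZMod (torusSide n)) = z →
      k % torusSide n = z.val := by
    rintro k z rfl
    exact (ZMod.val_natCast _ _).symm
  have hx : ((p.1.val : ℕ) : ZMod (torusSide n)) = p.1 := ZMod.natCast_zmod_val _
  have hy : ((p.2.val : ℕ) : ZMod (torusSide n)) = p.2 := ZMod.natCast_zmod_val _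
  have h0 := hval (p.1.val + p.2.val) (p.1 + p.2) (by push_cast; rw [hx, hy])
  have h1 := hval (p.1.val + torusSide n - p.2.val) (p.1 - p.2) (by
    rw [Nat.cast_sub (by have := p.2.val_lt; omega)]; push_cast; rw [hx, hy]; simp)
  have h2 := hval (p.1.val + 1) (p.1 + 1) (by push_cast; rw [hx])
  have h3 := hval (p.1.val + torusSide n - 1) (p.1 - 1) (by
    rw [Nat.cast_sub (by omega)]; push_cast; rw [hx]; simp)
  simp only [sum_range_succ, sum_range_zero, torusMove, h0, h1, h2, h3]
  simp only [torusVertex, shear, shift, Equiv.coe_fn_mk, Equiv.coe_fn_symm_mk, Prod.fst_swap,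
    Prod.snd_swap]
  ring

/-- The sum over all edges of the graph with `n` vertices in terms of the torus. -/
theorem sum_vertexStep {n : ℕ} [NeZero (torusSide n)] (φ : ℕ → ℕ → ℝ) :
    ∑ u ∈ range n, ∑ e ∈ range 16, φ u (vertexStep n e u)
      = ∑ p, (φ (torusVertex n p) (torusVertex n (shear p))
        + φ (torusVertex n p) (torusVertex n (shear.symm p))
        + φ (torusVertex n p) (torusVertex n (shift p))
        + φ (torusVertex n p) (torusVertex n (shift.symm p))
        + φ (torusVertex n p) (torusVertex n p.swap)
        + 3 * φ (torusVertex n p) (torusVertex n p))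
      + ∑ i ∈ Ico (torusSide n * torusSide n) (2 * n), 8 * φ (foldIndex n i) (foldIndex n i) := by
  have hm0 := NeZero.pos (torusSide n)
  set ψ : ℕ → ℕ → ℝ := fun i g => if i < torusSide n * torusSide n then φ (foldIndex n i)
    (foldIndex n ((torusMove (torusSide n) g (i / torusSide n) (i % torusSide n)).1 * torusSide n
      + (torusMove (torusSide n) g (i / torusSide n) (i % torusSide n)).2))
    else φ (foldIndex n i) (foldIndex n i) with hψ
  -- Labels below 8 leave from the index u, the others from n + u. Over all u this visits each index
  -- below 2n once, and indices from m² on carry loops.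
  have h1 : ∀ u ∈ range n, ∑ e ∈ range 16, φ u (vertexStep n e u)
      = ∑ g ∈ range 8, ψ u g + ∑ g ∈ range 8, ψ (n + u) g := by
    intro u hu
    rw [mem_range] at hu
    rw [show 16 = 8 + 8 from rfl, sum_range_add]
    have e1 : foldIndex n u = u := if_pos hu
    have e2 : foldIndex n (n + u) = u := by rw [foldIndex, if_neg (by omega)]; omega
    congr 1
    · refine sum_congr rfl fun g hg => ?_
      rw [mem_range] at hg
      simp only [vertexStep, startIndex, if_neg (show ¬ 8 ≤ g by omega), Nat.mod_eq_of_lt hg, hψ,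
        e1]
      split_ifs <;> rfl
    · refine sum_congr rfl fun g hg => ?_
      rw [mem_range] at hg
      simp only [vertexStep, startIndex, if_pos (show 8 ≤ 8 + g by omega), Nat.add_mod_left,
        Nat.mod_eq_of_lt hg, hψ, e2, add_comm u n]
      split_ifs <;> rfl
  rw [sum_congr rfl h1, sum_add_distrib, ← sum_range_add (fun i => ∑ g ∈ range 8, ψ i g), ← two_mul,
    ← sum_range_add_sum_Ico (fun i => ∑ g ∈ range 8, ψ i g) (torusSide_mul_self_le n),
    sum_range_mul_self]
  congr 1
  · refine sum_congr rfl fun p _ => ?_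
    rw [← sum_torusMove]
    refine sum_congr rfl fun g _ => ?_
    have h2 := p.2.val_lt
    have h3 := Cmd.mul_add_lt p.1.val_lt p.2.val_lt
    have h4 : (p.1.val * torusSide n + p.2.val) / torusSide n = p.1.val := by
      rw [add_comm, Nat.add_mul_div_right _ _ hm0, Nat.div_eq_of_lt h2, zero_add]
    have h5 : (p.1.val * torusSide n + p.2.val) % torusSide n = p.2.val := by
      rw [add_comm, Nat.add_mul_mod_self_right, Nat.mod_eq_of_lt h2]
    simp only [hψ, if_pos h3, h4, h5]
    rfl
  · refine sum_congr rfl fun i hi => ?_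
    rw [mem_Ico] at hi
    simp only [hψ, if_neg (not_lt.2 hi.1), sum_const, card_range, nsmul_eq_mul]
    norm_num

/-- This is the symmetry of the graph in summed form: reindexing the torus exchanges shear and shift
with their inverses, and the swap is an involution. -/
theorem sum_vertexStep_comm {n : ℕ} (φ : ℕ → ℕ → ℝ) :
    ∑ u ∈ range n, ∑ e ∈ range 16, φ u (vertexStep n e u)
      = ∑ u ∈ range n, ∑ e ∈ range 16, φ (vertexStep n e u) u := by
  rcases Nat.eq_zero_or_pos n with rfl | hn
  · simp
  have : NeZero (torusSide n) := ⟨(torusSide_pos hn).ne'⟩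
  rw [sum_vertexStep, sum_vertexStep fun a b => φ b a]
  congr 1
  simp only [sum_add_distrib]
  have h1 := (shear (m := torusSide n)).sum_comp fun p =>
    φ (torusVertex n (shear.symm p)) (torusVertex n p)
  have h2 := (shear (m := torusSide n)).sum_comp fun p =>
    φ (torusVertex n p) (torusVertex n (shear.symm p))
  have h3 := (shift (m := torusSide n)).sum_comp fun p =>
    φ (torusVertex n (shift.symm p)) (torusVertex n p)
  have h4 := (shift (m := torusSide n)).sum_comp fun p =>
    φ (torusVertex n p) (torusVertex n (shift.symm p))
  have h5 := (Equiv.prodComm (ZMod (torusSide n)) (ZMod (torusSide n))).sum_comp fun p =>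
    φ (torusVertex n p) (torusVertex n p.swap)
  simp only [Equiv.symm_apply_apply, Equiv.prodComm_apply, Prod.swap_swap] at h1 h2 h3 h4 h5
  rw [h1, ← h2, h3, ← h4, ← h5]
  ring

/-- The spectral gap of the graph with `n` vertices. -/
theorem sum_sq_le_sum_vertexStep {n : ℕ} (X : ℕ → ℝ) (hX : ∑ u ∈ range n, X u = 0) :
    ∑ u ∈ range n, X u ^ 2
      ≤ 4370 * ∑ u ∈ range n, ∑ e ∈ range 16, (X u - X (vertexStep n e u)) ^ 2 := by
  rcases Nat.eq_zero_or_pos n with rfl | hn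
  · simp
  have hm0 := torusSide_pos hn
  have : NeZero (torusSide n) := ⟨hm0.ne'⟩
  -- The pullback to the torus need not have mean zero, since only some vertices represent two
  -- points. Subtracting its mean c changes no difference along an edge, and it does not decrease
  -- the sum of squares over the vertices because X itself has sum zero.
  set c : ℝ := (∑ p, X (torusVertex n p)) / (torusSide n * torusSide n : ℕ) with hc
  have hcard : (Fintype.card (ZMod (torusSide n) × ZMod (torusSide n)) : ℝ)
      = (torusSide n * torusSide n : ℕ) := by
    rw [Fintype.card_prod, ZMod.card]
  have hmm : ((torusSide n * torusSide n : ℕ) : ℝ) ≠ 0 := by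
    exact_mod_cast (Nat.mul_pos hm0 hm0).ne'
  have h1 := sum_sq_le_energy (m := torusSide n) (fun p => X (torusVertex n p) - c) (by
    rw [sum_sub_distrib, sum_const, card_univ, nsmul_eq_mul, hcard, hc]
    field_simp
    ring)
  have h2 : ∑ u ∈ range n, X u ^ 2
      ≤ ∑ p : ZMod (torusSide n) × ZMod (torusSide n), (X (torusVertex n p) - c) ^ 2 := by
    have e1 : ∑ p : ZMod (torusSide n) × ZMod (torusSide n), (X (torusVertex n p) - c) ^ 2
        = ∑ i ∈ range (torusSide n * torusSide n), (X (foldIndex n i) - c) ^ 2 :=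
      (sum_range_mul_self fun i => (X (foldIndex n i) - c) ^ 2).symm
    have e2 : ∑ u ∈ range n, (X u - c) ^ 2 = ∑ u ∈ range n, X u ^ 2 + n * c ^ 2 := by
      have : ∀ u, (X u - c) ^ 2 = X u ^ 2 - 2 * c * X u + c ^ 2 := fun u => by ring
      simp only [this, sum_add_distrib, sum_sub_distrib, ← mul_sum, hX, sum_const, card_range,
        nsmul_eq_mul]
      ring
    have e3 : ∑ u ∈ range n, (X u - c) ^ 2
        ≤ ∑ i ∈ range (torusSide n * torusSide n), (X (foldIndex n i) - c) ^ 2 := by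
      have : ∑ u ∈ range n, (X u - c) ^ 2 = ∑ i ∈ range n, (X (foldIndex n i) - c) ^ 2 :=
        sum_congr rfl fun u hu => by rw [foldIndex, if_pos (mem_range.1 hu)]
      rw [this]
      exact sum_le_sum_of_subset_of_nonneg (range_mono (le_torusSide_mul_self n))
        fun i _ _ => sq_nonneg _
    have : 0 ≤ (n : ℝ) * c ^ 2 := by positivity
    rw [e1]
    linarith
  have h3 : ∑ p : ZMod (torusSide n) × ZMod (torusSide n),
      ((X (torusVertex n p) - X (torusVertex n (shear p))) ^ 2
      + (X (torusVertex n p) - X (torusVertex n (shift p))) ^ 2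
      + (X (torusVertex n p) - X (torusVertex n p.swap)) ^ 2)
      ≤ ∑ u ∈ range n, ∑ e ∈ range 16, (X u - X (vertexStep n e u)) ^ 2 := by
    rw [sum_vertexStep fun a b => (X a - X b) ^ 2]
    refine le_add_of_le_of_nonneg (sum_le_sum fun p _ => ?_) (sum_nonneg fun i _ => by positivity)
    have := sq_nonneg (X (torusVertex n p) - X (torusVertex n (shear.symm p)))
    have := sq_nonneg (X (torusVertex n p) - X (torusVertex n (shift.symm p)))
    have := sq_nonneg (X (torusVertex n p) - X (torusVertex n p))
    linarith
  simp only [sub_sub_sub_cancel_right] at h1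
  calc ∑ u ∈ range n, X u ^ 2 ≤ _ := h2
    _ ≤ _ := h1
    _ ≤ _ := mul_le_mul_of_nonneg_left h3 (by norm_num)

end

/-! ### Adjacency matrix and walks -/

section

open Finset

/-- The adjacency matrix of the graph with `n` vertices and degree `16`. -/
def stepMatrix (n : ℕ) : Matrix (Fin n) (Fin n) ℕ :=
  Matrix.of fun u v => #{e ∈ range 16 | vertexStep n e u = v}

theorem sum_stepMatrix_mul {R : Type*} [Semiring R] {n : ℕ} (u : Fin n) (φ : Fin n → R) :
    ∑ v, (stepMatrix n u v : R) * φ v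
      = ∑ e ∈ range 16, φ ⟨vertexStep n e u, vertexStep_lt u.2⟩ := by
  have h : ∀ v, (stepMatrix n u v : R) * φ v
      = ∑ e ∈ range 16, if (⟨vertexStep n e u, vertexStep_lt u.2⟩ : Fin n) = v then φ v else 0 := by
    intro v
    rw [← sum_filter, sum_const, nsmul_eq_mul]
    simp only [stepMatrix, Matrix.of_apply, Fin.ext_iff]
  simp only [h]
  rw [sum_comm]
  simp

theorem sum_stepMatrix {n : ℕ} (u : Fin n) : ∑ v, stepMatrix n u v = 16 := by
  simpa using sum_stepMatrix_mul (R := ℕ) u fun _ => 1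

/-- An entry is a sum over all edges of the indicator of a pair, to which `sum_vertexStep_comm`
applies. -/
theorem stepMatrix_symm {n : ℕ} (u v : Fin n) : stepMatrix n u v = stepMatrix n v u := by
  have h : ∀ a b : Fin n, (stepMatrix n a b : ℝ)
      = ∑ i ∈ range n, ∑ e ∈ range 16, if i = a ∧ vertexStep n e i = b then 1 else 0 := by
    intro a b
    rw [sum_eq_single_of_mem (a : ℕ) (mem_range.2 a.2)
      fun i _ hi => sum_eq_zero fun e _ => if_neg fun h => hi h.1]
    simp [stepMatrix]
  have := sum_vertexStep_comm (n := n) fun i j => if i = u ∧ j = v then 1 else 0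
  rw [← h] at this
  simp only [and_comm (a := _ = (u : ℕ))] at this
  rw [← h] at this
  exact_mod_cast this

theorem vertexStep_eq_self {n e u : ℕ} (hu : u < n) (he : 5 ≤ e % 8) : vertexStep n e u = u := by
  simp only [vertexStep]
  split_ifs with h
  · have h1 : ∀ x y, torusMove (torusSide n) (e % 8) x y = (x, y) := by
      intro x y
      obtain ⟨k, hk⟩ := Nat.exists_eq_add_of_le' he
      rw [hk]
      rfl
    rw [h1, mul_comm, Nat.div_add_mod, foldIndex, startIndex]
    split_ifs <;> omega
  · rfl

/-- The six labels are the identity moves at the two points of a vertex. These loops are needed for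
the contraction. -/
theorem le_stepMatrix_self {n : ℕ} (u : Fin n) : 6 ≤ stepMatrix n u u := by
  have h : ({5, 6, 7, 13, 14, 15} : Finset ℕ) ⊆ {e ∈ range 16 | vertexStep n e u = u} := by
    intro e he
    rw [mem_filter, mem_range]
    have : e < 16 ∧ 5 ≤ e % 8 := by
      simp only [mem_insert, mem_singleton] at he
      omega
    exact ⟨this.1, vertexStep_eq_self u.2 this.2⟩
  exact card_le_card h

theorem sum_range_mul {M : Type*} [AddCommMonoid M] {b : ℕ} (hb : 0 < b) (K : ℕ) (h : ℕ → M) :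
    ∑ w ∈ range (b * K), h w = ∑ e ∈ range b, ∑ w ∈ range K, h (b * w + e) := by
  rw [← sum_product']
  refine sum_nbij' (fun w => (w % b, w / b)) (fun p => b * p.2 + p.1) ?_ ?_ ?_ ?_ ?_
  · intro w hw
    rw [mem_range] at hw
    simp only [mem_product, mem_range]
    exact ⟨Nat.mod_lt _ hb, Nat.div_lt_of_lt_mul hw⟩
  · intro p hp
    simp only [mem_product, mem_range] at hp ⊢
    nlinarith
  · intro w _
    exact Nat.div_add_mod _ _
  · intro p hp
    simp only [mem_product, mem_range] at hp
    ext
    · simp [Nat.mod_eq_of_lt hp.1]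
    · simp [Nat.mul_add_div hb, Nat.div_eq_of_lt hp.1]
  · intro w _
    rw [Nat.div_add_mod]

/-- The lowest digit of a code is the first step of its walk, and w ↦ (w % 16, w / 16) splits the
codes accordingly, matching the expansion of the matrix power at its first factor. -/
theorem card_vertexWalk {n : ℕ} (k : ℕ) (u v : Fin n) :
    #{w ∈ range (16 ^ k) | vertexWalk n k u w = v} = (stepMatrix n ^ k) u v := by
  induction k generalizing u with
  | zero => simp [vertexWalk, Matrix.one_apply, Fin.ext_iff, filter_singleton, apply_ite card]
  | succ k ih =>
    have h := sum_stepMatrix_mul (R := ℕ) u fun x => (stepMatrix n ^ k) x v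
    simp only [Nat.cast_id] at h
    rw [pow_succ' (stepMatrix n), Matrix.mul_apply, h, card_filter, pow_succ',
      sum_range_mul (by norm_num)]
    refine sum_congr rfl fun e he => ?_
    rw [← ih, card_filter]
    refine sum_congr rfl fun w _ => ?_
    rw [mem_range] at he
    rw [vertexWalk, Nat.mul_add_mod, Nat.mod_eq_of_lt he, Nat.mul_add_div (by norm_num),
      Nat.div_eq_of_lt he, add_zero]

/-- Only codes with at most `Nat.log 16 d` digits count, so every d ≠ 0 gives a full matrix power
and the graph is symmetric for all d. The case d = 0 is separate: there is no code, while the zeroth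
power is the identity. -/
theorem walkCount_eq {n d : ℕ} (u v : Fin n) :
    walkCount n d u v = if d = 0 then 0 else (stepMatrix n ^ Nat.log 16 d) u v := by
  split_ifs with hd
  · subst hd
    rfl
  · rw [← card_vertexWalk, walkCount]
    congr 1
    ext w
    have h1 : 16 ^ Nat.log 16 d ≤ d := Nat.pow_log_le_self 16 hd
    have h2 : w / 16 ^ Nat.log 16 d = 0 ↔ w < 16 ^ Nat.log 16 d :=
      Nat.div_eq_zero_iff_lt (by positivity)
    simp only [mem_filter, mem_Ico, mem_range, IsWalkCode, h2, zero_le, true_and]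
    exact ⟨fun h => h.2, fun h => ⟨h.1.trans_le h1, h⟩⟩

theorem stepMatrix_pow_symm {n : ℕ} (k : ℕ) (u v : Fin n) :
    (stepMatrix n ^ k) u v = (stepMatrix n ^ k) v u := by
  have h : (stepMatrix n).IsSymm := Matrix.IsSymm.ext fun u v => stepMatrix_symm v u
  exact (h.pow k).apply v u

/-- The graph on `n` vertices whose edges are the walks of length `Nat.log 16 d`. -/
def walkGraph (n d : ℕ) : UndirectedMultigraph (Fin n) where
  mult u v := walkCount n d u v
  symm u v := by rw [walkCount_eq, walkCount_eq, stepMatrix_pow_symm]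

theorem isExplicitFamily_walkGraph : IsExplicitFamily fun n d => (walkGraph n d).doubleCover :=
  isExplicitFamily_of_mult _ fun _ _ _ _ => rfl

theorem walkGraph_mult {n k : ℕ} (u v : Fin n) :
    (walkGraph n (16 ^ k)).mult u v = (stepMatrix n ^ k) u v := by
  change walkCount n (16 ^ k) u v = _
  rw [walkCount_eq, if_neg (by positivity), Nat.log_pow (by norm_num)]

theorem sum_stepMatrix_pow {n : ℕ} (k : ℕ) (u : Fin n) : ∑ v, (stepMatrix n ^ k) u v = 16 ^ k := by
  induction k with
  | zero => simp [Matrix.one_apply]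
  | succ k ih =>
    simp only [pow_succ (stepMatrix n), Matrix.mul_apply]
    rw [sum_comm]
    simp only [← mul_sum, sum_stepMatrix, ← sum_mul, ih]
    rw [pow_succ]

theorem isRegular_walkGraph (n k : ℕ) : (walkGraph n (16 ^ k)).IsRegular (16 ^ k) := fun u => by
  simp only [walkGraph_mult, sum_stepMatrix_pow]

theorem sum_sq_le_sum_stepMatrix {n : ℕ} (x : Fin n → ℝ) (hx : ∑ u, x u = 0) :
    ∑ u, x u ^ 2 ≤ 4370 * ∑ u, ∑ v, (stepMatrix n u v : ℝ) * (x u - x v) ^ 2 := by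
  have h := sum_sq_le_sum_vertexStep (n := n) (fun i => if h : i < n then x ⟨i, h⟩ else 0) (by
    rw [sum_range]
    simpa using hx)
  simp only [sum_range (n := n), Fin.is_lt, vertexStep_lt, dif_pos, Fin.eta] at h
  simpa only [sum_stepMatrix_mul] using h

end

/-! ### From a Poincaré inequality to spectral expansion -/

section

open Finset

namespace Matrix

variable {V : Type*} [Fintype V]

theorem sum_mulVec_of_colSum {A : Matrix V V ℝ} {r : ℝ} (hcol : ∀ v, ∑ u, A u v = r) (x : V → ℝ) :
    ∑ u, (A *ᵥ x) u = r * ∑ v, x v := by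
  simp only [mulVec, dotProduct]
  rw [sum_comm, mul_sum]
  exact sum_congr rfl fun v _ => by rw [← sum_mul, hcol]

/-- This is Cauchy–Schwarz for the weights of one row: the variance about the weighted mean t is
nonnegative. -/
theorem sq_mulVec_le {B : Matrix V V ℝ} {r : ℝ} (hr : 0 < r) (hB : ∀ u v, 0 ≤ B u v)
    (hrow : ∀ u, ∑ v, B u v = r) (x : V → ℝ) (u : V) :
    (B *ᵥ x) u ^ 2 ≤ r * (B *ᵥ fun v => x v ^ 2) u := by
  set t : ℝ := (B *ᵥ x) u / r with ht
  have h1 : 0 ≤ ∑ v, B u v * (x v - t) ^ 2 :=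
    sum_nonneg fun v _ => mul_nonneg (hB u v) (sq_nonneg _)
  have h2 : ∑ v, B u v * (x v - t) ^ 2
      = (B *ᵥ fun v => x v ^ 2) u - 2 * t * (B *ᵥ x) u + t ^ 2 * r := by
    simp only [mulVec, dotProduct]
    rw [← hrow u, mul_sum, mul_sum, ← sum_sub_distrib, ← sum_add_distrib]
    exact sum_congr rfl fun v _ => by ring
  have h3 : t * r = (B *ᵥ x) u := div_mul_cancel₀ _ hr.ne'
  rw [h2] at h1
  nlinarith [mul_nonneg hr.le h1]

theorem sum_sq_mulVec_le {B : Matrix V V ℝ} {r : ℝ} (hr : 0 < r) (hB : ∀ u v, 0 ≤ B u v)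
    (hrow : ∀ u, ∑ v, B u v = r) (hcol : ∀ v, ∑ u, B u v = r) (x : V → ℝ) :
    ∑ u, (B *ᵥ x) u ^ 2 ≤ r ^ 2 * ∑ v, x v ^ 2 :=
  calc _ ≤ ∑ u, r * (B *ᵥ fun v => x v ^ 2) u := sum_le_sum fun u _ => sq_mulVec_le hr hB hrow x u
    _ = _ := by rw [← mul_sum, sum_mulVec_of_colSum hcol]; ring

theorem sum_mul_sub_sq {A : Matrix V V ℝ} {r : ℝ} (hrow : ∀ u, ∑ v, A u v = r)
    (hcol : ∀ v, ∑ u, A u v = r) (x : V → ℝ) :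
    ∑ u, ∑ v, A u v * (x u - x v) ^ 2 = 2 * r * ∑ u, x u ^ 2 - 2 * ∑ u, x u * (A *ᵥ x) u := by
  have h1 : ∑ u, ∑ v, A u v * x u ^ 2 = r * ∑ u, x u ^ 2 := by
    simp only [← sum_mul, hrow, mul_sum]
  have h2 : ∑ u, ∑ v, A u v * x v ^ 2 = r * ∑ u, x u ^ 2 := by
    rw [sum_comm]
    simp only [← sum_mul, hcol, mul_sum]
  have h3 : ∑ u, x u * (A *ᵥ x) u = ∑ u, ∑ v, A u v * (x u * x v) := by
    simp only [mulVec, dotProduct, mul_sum]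
    exact sum_congr rfl fun u _ => sum_congr rfl fun v _ => by ring
  rw [h3, show 2 * r * ∑ u, x u ^ 2 = r * ∑ u, x u ^ 2 + r * ∑ u, x u ^ 2 by ring]
  nth_rw 1 [← h1]
  rw [← h2]
  simp only [mul_sum, ← sum_sub_distrib, ← sum_add_distrib]
  exact sum_congr rfl fun u _ => sum_congr rfl fun v _ => by ring

/-- A Poincaré inequality and loops at all vertices make the matrix of a graph contract the vectors
orthogonal to the constants. -/
theorem sum_sq_mulVec_le_of_poincare [DecidableEq V] {A : Matrix V V ℝ} {l r c : ℝ} (hc : 0 < c)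
    (hl : 0 ≤ l) (hlr : l < r) (hA : ∀ u v, 0 ≤ A u v) (hloop : ∀ u, l ≤ A u u)
    (hrow : ∀ u, ∑ v, A u v = r) (hcol : ∀ v, ∑ u, A u v = r) {x : V → ℝ}
    (hx : ∑ u, x u ^ 2 ≤ c * ∑ u, ∑ v, A u v * (x u - x v) ^ 2) :
    ∑ u, (A *ᵥ x) u ^ 2 ≤ (r ^ 2 - l / c) * ∑ u, x u ^ 2 := by
  -- Removing l loops leaves a nonnegative B with row and column sums r - l, so ‖Bx‖ ≤ (r - l) ‖x‖.
  -- The Poincaré inequality says 2⟨x, Ax⟩ ≤ (2r - 1/c) ‖x‖². Expanding ‖(B + l)x‖² gives the factor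
  -- (r - l)² + l (2r - 1/c) - l² = r² - l/c. The loops thus control both ends of the spectrum at
  -- once.
  set B : Matrix V V ℝ := A - l • (1 : Matrix V V ℝ) with hB
  have hBx : ∀ u, (A *ᵥ x) u = (B *ᵥ x) u + l * x u := fun u => by
    simp [hB, sub_mulVec, smul_mulVec]
  have hB0 : ∀ u v, 0 ≤ B u v := by
    intro u v
    rcases eq_or_ne u v with rfl | h
    · simpa [hB] using hloop u
    · simpa [hB, one_apply_ne h] using hA u v
  have hBrow : ∀ u, ∑ v, B u v = r - l := fun u => by
    simp [hB, sum_sub_distrib, hrow, one_apply]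
  have hBcol : ∀ v, ∑ u, B u v = r - l := fun v => by
    simp [hB, sum_sub_distrib, hcol, one_apply]
  have h1 := sum_sq_mulVec_le (sub_pos.2 hlr) hB0 hBrow hBcol x
  have h2 : ∑ u, (A *ᵥ x) u ^ 2 = ∑ u, (B *ᵥ x) u ^ 2 + 2 * l * ∑ u, x u * (A *ᵥ x) u
      - l ^ 2 * ∑ u, x u ^ 2 := by
    simp only [mul_sum, ← sum_sub_distrib, ← sum_add_distrib]
    exact sum_congr rfl fun u _ => by rw [hBx]; ring
  rw [sum_mul_sub_sq hrow hcol] at hx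
  have h3 : l / c * ∑ u, x u ^ 2
      ≤ l * (2 * r * ∑ u, x u ^ 2 - 2 * ∑ u, x u * (A *ᵥ x) u) := by
    rw [div_mul_eq_mul_div, mul_div_assoc]
    exact mul_le_mul_of_nonneg_left ((div_le_iff₀' hc).2 hx) hl
  rw [h2]
  nlinarith

end Matrix

/-- The bound for the second eigenvalue of the graphs of degree `16`. -/
noncomputable def gapConstant : ℝ := √(1 - 6 / (256 * 4370))

theorem gapConstant_sq : gapConstant ^ 2 = 1 - 6 / (256 * 4370) :=
  Real.sq_sqrt (by norm_num)

theorem gapConstant_nonneg : 0 ≤ gapConstant := Real.sqrt_nonneg _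

theorem gapConstant_lt_one : gapConstant < 1 := by
  rw [← sq_lt_one_iff₀ gapConstant_nonneg, gapConstant_sq]
  norm_num

open Matrix in
theorem norm_stepMatrix_mulVec_le {n : ℕ} {x : Fin n → ℝ} (hx : ∑ u, x u = 0) :
    ‖WithLp.toLp 2 ((stepMatrix n).map ((↑) : ℕ → ℝ) *ᵥ x)‖
      ≤ 16 * gapConstant * ‖WithLp.toLp 2 x‖ := by
  have hrow : ∀ u, ∑ v, (stepMatrix n).map ((↑) : ℕ → ℝ) u v = 16 := fun u => by
    simpa using congrArg (Nat.cast (R := ℝ)) (sum_stepMatrix u)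
  -- With six loops, degree 16 and Poincaré constant 4370, the factor r² - l/c is 16² times
  -- `gapConstant ^ 2`.
  have h := sum_sq_mulVec_le_of_poincare (A := (stepMatrix n).map ((↑) : ℕ → ℝ)) (l := 6) (r := 16)
    (c := 4370) (by norm_num) (by norm_num) (by norm_num) (fun u v => by simp)
    (fun u => by
      rw [map_apply]
      exact_mod_cast le_stepMatrix_self u) hrow
    (fun v => by
      rw [← hrow v]
      simp only [map_apply, stepMatrix_symm _ v])
    (sum_sq_le_sum_stepMatrix x hx)
  rw [← pow_le_pow_iff_left₀ (norm_nonneg _)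
    (mul_nonneg (mul_nonneg (by norm_num) gapConstant_nonneg) (norm_nonneg _)) two_ne_zero,
    mul_pow, mul_pow, gapConstant_sq, EuclideanSpace.norm_sq_eq, EuclideanSpace.norm_sq_eq]
  simp only [Real.norm_eq_abs, sq_abs]
  refine h.trans_eq ?_
  norm_num

open Matrix in
theorem norm_stepMatrix_pow_mulVec_le {n : ℕ} {x : Fin n → ℝ} (hx : ∑ u, x u = 0) (k : ℕ) :
    ‖WithLp.toLp 2 ((stepMatrix n).map ((↑) : ℕ → ℝ) ^ k *ᵥ x)‖
      ≤ (16 * gapConstant) ^ k * ‖WithLp.toLp 2 x‖ := by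
  have hcol : ∀ v, ∑ u, (stepMatrix n).map ((↑) : ℕ → ℝ) u v = 16 := fun v => by
    simpa [stepMatrix_symm v] using congrArg (Nat.cast (R := ℝ)) (sum_stepMatrix v)
  have hsum : ∀ k, ∑ u, ((stepMatrix n).map ((↑) : ℕ → ℝ) ^ k *ᵥ x) u = 0 := by
    intro k
    induction k with
    | zero => simpa using hx
    | succ k ih => rw [pow_succ', ← mulVec_mulVec, sum_mulVec_of_colSum hcol, ih, mul_zero]
  induction k with
  | zero => simp
  | succ k ih =>
    rw [pow_succ', ← mulVec_mulVec, pow_succ', mul_assoc]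
    exact (norm_stepMatrix_mulVec_le (hsum k)).trans
      (mul_le_mul_of_nonneg_left ih (mul_nonneg (by norm_num) gapConstant_nonneg))

open Matrix in
theorem isSpectralExpander_walkGraph {n k : ℕ} {lam : ℝ} (hlam : gapConstant ^ k ≤ lam) :
    (walkGraph n (16 ^ k)).IsSpectralExpander (16 ^ k) lam := by
  refine ⟨isRegular_walkGraph n k, fun x hx => ?_⟩
  have h1 : (walkGraph n (16 ^ k)).walkMatrix (16 ^ k)
      = ((16 : ℝ) ^ k)⁻¹ • (stepMatrix n).map ((↑) : ℕ → ℝ) ^ k := by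
    have h2 : (stepMatrix n ^ k).map ((↑) : ℕ → ℝ) = (stepMatrix n).map ((↑) : ℕ → ℝ) ^ k :=
      Matrix.map_pow _ (Nat.castRingHom ℝ) k
    rw [← h2]
    ext u v
    simp [UndirectedMultigraph.walkMatrix, walkGraph_mult, div_eq_inv_mul]
  rw [h1, smul_mulVec, WithLp.toLp_smul, norm_smul, norm_inv, norm_pow, Real.norm_ofNat,
    inv_mul_le_iff₀ (by positivity), ← mul_assoc]
  refine (norm_stepMatrix_pow_mulVec_le hx k).trans (mul_le_mul_of_nonneg_right ?_ (norm_nonneg _))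
  rw [mul_pow]
  exact mul_le_mul_of_nonneg_left hlam (by positivity)

end

/-! ### From spectral expansion to extractors, and the choice of parameters -/

section

open Finset

namespace UndirectedMultigraph

variable {V : Type} [Fintype V]

theorem IsRegular.isBiregular_doubleCover {G : UndirectedMultigraph V} {d : ℕ}
    (h : G.IsRegular d) : G.doubleCover.IsBiregular d :=
  ⟨h, fun v => by simpa only [doubleCover, G.symm _ v] using h v⟩

/-- The double cover of a spectral expander is an extractor. -/
theorem IsSpectralExpander.isExtractor_doubleCover {G : UndirectedMultigraph V} {d k : ℕ}
    {lam ε : ℝ} (h : G.IsSpectralExpander d lam) (hd : 0 < d) (hε : 0 < ε) (hk : 0 < k)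
    (hlam : lam ^ 2 * Fintype.card V < 4 * k * ε ^ 2) : G.doubleCover.IsExtractor d k ε := by
  classical
  refine ⟨h.1, fun S T hS => ?_⟩
  have hs : (0 : ℝ) < #S := by exact_mod_cast hk.trans_le hS
  have hd' : (0 : ℝ) < d := by exact_mod_cast hd
  have hN : (0 : ℝ) < Fintype.card V := by
    -- A set S of positive size forces V to be nonempty, so graphs without vertices need no separate
    -- treatment.
    exact_mod_cast (hk.trans_le hS).trans_le S.card_le_univ
  set N : ℝ := (Fintype.card V : ℝ) with hNdef
  set t : ℝ := #T / N with ht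
  set x : V → ℝ := fun v => (if v ∈ T then 1 else 0) - t with hxdef
  have hind : ∑ v, (if v ∈ T then (1 : ℝ) else 0) = t * N := by
    rw [ht, div_mul_cancel₀ _ hN.ne']
    simp
  have hcard : ∑ _v : V, (1 : ℝ) = N := by simp [hNdef]
  have hx : ∑ v, x v = 0 := by
    simp only [hxdef]
    rw [sum_sub_distrib, hind, ← mul_one t, ← mul_sum, hcard]
    ring
  -- The centred indicator of T has square norm N t (1 - t) ≤ N / 4, which is the source of the
  -- factor 4 in `hlam`.
  have hxsq : ∑ v, x v ^ 2 ≤ N / 4 := by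
    have h1 : ∀ v, x v ^ 2 = (1 - 2 * t) * (if v ∈ T then 1 else 0) + t ^ 2 * 1 := fun v => by
      simp only [hxdef]
      split_ifs <;> ring
    simp only [h1]
    rw [sum_add_distrib, ← mul_sum, ← mul_sum, hind, hcard]
    nlinarith [mul_nonneg hN.le (sq_nonneg (2 * t - 1))]
  set y : V → ℝ := (G.walkMatrix d).mulVec x with hydef
  have hy : ∀ u, y u = (∑ v ∈ T, (G.mult u v : ℝ)) / d - t := by
    intro u
    have h1 : (∑ v, (G.mult u v : ℝ)) = d := by exact_mod_cast h.1 u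
    simp only [hydef, Matrix.mulVec, dotProduct, walkMatrix, Matrix.of_apply, hxdef, mul_sub,
      sum_sub_distrib, mul_ite, mul_one, mul_zero, sum_ite_mem, univ_inter, ← sum_mul, ← sum_div]
    rw [h1, div_self hd'.ne', one_mul]
  have hysum : ∑ u ∈ S, y u = #S * ((G.doubleCover.edgesBetween S T : ℝ) / (d * #S) - t) := by
    simp only [hy, sum_sub_distrib, ← sum_div, sum_const, nsmul_eq_mul,
      BipartiteMultigraph.edgesBetween, doubleCover]
    push_cast
    field_simp
  have hnorm : ∑ u, y u ^ 2 ≤ lam ^ 2 * ∑ v, x v ^ 2 := by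
    have h1 := pow_le_pow_left₀ (norm_nonneg _) (h.2 x hx) 2
    rw [mul_pow, EuclideanSpace.norm_sq_eq, EuclideanSpace.norm_sq_eq] at h1
    simpa only [Real.norm_eq_abs, sq_abs] using h1
  -- The deviation δ of S and T is the average of y over S, so Cauchy–Schwarz gives |S| δ² ≤ ‖y‖² ≤
  -- λ² N / 4 < k ε² ≤ |S| ε².
  have hCS : (∑ u ∈ S, y u) ^ 2 ≤ #S * ∑ u, y u ^ 2 :=
    sq_sum_le_card_mul_sum_sq.trans (mul_le_mul_of_nonneg_left
      (sum_le_sum_of_subset_of_nonneg (subset_univ S) fun _ _ _ => sq_nonneg _) hs.le)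
  rw [hysum, mul_pow, sq (#S : ℝ), mul_assoc] at hCS
  have h2 := le_of_mul_le_mul_left hCS hs
  have h3 : lam ^ 2 * ∑ v, x v ^ 2 ≤ lam ^ 2 * (N / 4) :=
    mul_le_mul_of_nonneg_left hxsq (sq_nonneg _)
  have h4 : (k : ℝ) * ε ^ 2 ≤ #S * ε ^ 2 :=
    mul_le_mul_of_nonneg_right (by exact_mod_cast hS) (sq_nonneg _)
  refine abs_lt_of_sq_lt_sq (lt_of_mul_lt_mul_left ?_ hs.le) hε.le
  linarith

end UndirectedMultigraph

/-- The length of the walks that reduce the second eigenvalue to `1 / 16`. -/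
noncomputable def mixingLength : ℕ :=
  (exists_pow_lt_of_lt_one (by norm_num : (0 : ℝ) < 1 / 16) gapConstant_lt_one).choose

theorem gapConstant_pow_mixingLength : gapConstant ^ mixingLength < 1 / 16 :=
  (exists_pow_lt_of_lt_one (by norm_num : (0 : ℝ) < 1 / 16) gapConstant_lt_one).choose_spec

theorem le_sixteen_pow_clog (x : ℝ) : x ≤ 16 ^ Nat.clog 16 ⌈x⌉₊ :=
  (Nat.le_ceil x).trans (by exact_mod_cast Nat.le_pow_clog (by norm_num) ⌈x⌉₊)

/-- Rounding up to a power of 16 costs at most a factor 16 and the ceiling at most 1, so the degree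
stays polynomial. -/
theorem sixteen_pow_clog_le {x : ℝ} (hx : 0 ≤ x) :
    (16 : ℝ) ^ Nat.clog 16 ⌈x⌉₊ ≤ 16 * x + 16 := by
  rcases le_or_gt ⌈x⌉₊ 1 with h | h
  · rw [Nat.clog_of_right_le_one h]
    linarith
  · have h1 := Nat.pow_pred_clog_lt_self (by norm_num : 1 < 16) h
    have h2 : Nat.clog 16 ⌈x⌉₊ = (Nat.clog 16 ⌈x⌉₊).pred + 1 :=
      (Nat.succ_pred_eq_of_pos (Nat.clog_pos (by norm_num) h)).symm
    have h3 : (16 : ℝ) ^ (Nat.clog 16 ⌈x⌉₊).pred < ⌈x⌉₊ := by exact_mod_cast h1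
    rw [h2, pow_succ]
    linarith [Nat.ceil_lt_add_one hx]

end

theorem mainTheorem9 :
    ∃ (D : ℝ → ℝ → ℕ) (P : MvPolynomial (Fin 2) ℝ)
      (H : ∀ n _d : ℕ, UndirectedMultigraph (Fin n)),
      IsExplicitFamily (fun n d => (H n d).doubleCover) ∧
      ∀ ε α : ℝ, 0 < ε → 0 < α → α < 1 →
        0 < D ε α ∧
        (D ε α : ℝ) ≤ MvPolynomial.eval ![1 / ε, 1 / α] P ∧
        ∀ n k : ℕ, max ⌊α * (n : ℝ)⌋₊ 1 ≤ k →
          (H n (D ε α)).doubleCover.IsExtractor (D ε α) k ε ∧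
          (H n (D ε α)).doubleCover.IsBiregular (D ε α) ∧
          (H n (D ε α)).IsSpectralExpander (D ε α) (ε * √(α / 2)) := by
  -- With ℓ = `mixingLength` an absolute constant and 16^j the power of 16 just above 2 / (ε α),
  -- walks of length ℓ j have expansion at most 16^(-j) ≤ ε α / 2. Their degree is (16^j)^ℓ ≤ (32 /
  -- (ε α) + 16)^ℓ, a polynomial of fixed degree.
  refine ⟨fun ε α => 16 ^ (mixingLength * Nat.clog 16 ⌈2 / (ε * α)⌉₊),
    (MvPolynomial.C 32 * MvPolynomial.X 0 * MvPolynomial.X 1 + MvPolynomial.C 16) ^ mixingLength,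
    walkGraph, isExplicitFamily_walkGraph, fun ε α hε hα hα1 => ?_⟩
  have hεα : 0 < ε * α := mul_pos hε hα
  -- Since α / 2 ≤ 1, replacing it by its square root only weakens the bound on the expansion.
  have hroot : α / 2 ≤ √(α / 2) := Real.le_sqrt_of_sq_le (by nlinarith)
  refine ⟨by positivity, ?_, fun n k hk => ?_⟩
  · push_cast
    rw [mul_comm mixingLength, pow_mul]
    simp only [map_pow, map_add, map_mul, MvPolynomial.eval_C, MvPolynomial.eval_X,
      Matrix.cons_val_zero, Matrix.cons_val_one]
    refine pow_le_pow_left₀ (by positivity) ((sixteen_pow_clog_le (by positivity)).trans_eq ?_) _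
    field_simp
    ring
  · have hexp := isSpectralExpander_walkGraph (n := n) (lam := ε * √(α / 2))
      (k := mixingLength * Nat.clog 16 ⌈2 / (ε * α)⌉₊) (by
        have h1 := le_sixteen_pow_clog (2 / (ε * α))
        rw [div_le_iff₀ hεα] at h1
        calc gapConstant ^ (mixingLength * Nat.clog 16 ⌈2 / (ε * α)⌉₊)
            ≤ (1 / 16) ^ Nat.clog 16 ⌈2 / (ε * α)⌉₊ := by
              rw [pow_mul]
              exact pow_le_pow_left₀ (pow_nonneg gapConstant_nonneg _)
                gapConstant_pow_mixingLength.le _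
          _ ≤ ε * (α / 2) := by
              rw [one_div, inv_pow, inv_le_iff_one_le_mul₀' (by positivity)]
              linarith
          _ ≤ ε * √(α / 2) := mul_le_mul_of_nonneg_left hroot hε.le)
    have hk0 : 0 < k := (le_max_right _ _).trans hk
    refine ⟨hexp.isExtractor_doubleCover (by positivity) hε hk0 ?_,
      hexp.1.isBiregular_doubleCover, hexp⟩
    -- The floor loses less than 1 ≤ k. The extractor criterion only asks for α n < 8 k, so there is
    -- room to spare.
    have h1 : α * n < 2 * k := by
      have h2 : (⌊α * (n : ℝ)⌋₊ : ℝ) ≤ k := by exact_mod_cast (le_max_left _ _).trans hk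
      have h3 : (1 : ℝ) ≤ k := by exact_mod_cast hk0
      linarith [Nat.lt_floor_add_one (α * (n : ℝ))]
    rw [mul_pow, Real.sq_sqrt (half_pos hα).le, Fintype.card_fin]
    have h4 : (0 : ℝ) < k := by exact_mod_cast hk0
    nlinarith [mul_lt_mul_of_pos_left h1 (pow_pos hε 2), mul_pos (pow_pos hε 2) h4]
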